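/- Fix $d\in\mathbb N$ and write points of phase space $\mathbb R^{2d}=\mathbb R^d\times\mathbb R^d$ as $z=(x,\xi)$. Let $\sigma((x,\xi),(x',\xi'))=x'\cdot\xi-x\cdot\xi'$. The symplectic Fourier transform of $f\in\mathcal S(\mathbb R^{2d})$ is $\mathcal F_\sigma f(w)=\int_{\mathbb R^{2d}} f(z)e^{-2\pi i\sigma(w,z)}\,dz$; it is extended to tempered distributions $u\in\mathcal S'(\mathbb R^{2d})$ by duality, $\langle\mathcal F_\sigma u,\varphi\rangle=\langle u,\ z\mapsto\int\varphi(w)e^{-2\pi i\sigma(w,z)}\,dw\rangle$ for $\varphi\in\mathcal S(\mathbb R^{2d})$. For $u\in\mathcal S'(\mathbb R^{2d})$ let $\rho(u):\mathcal S(\mathbb R^d)\to\mathcal S'(\mathbb R^d)$ be the continuous linear operator with Schwartz kernel $k_u(t,x)=(\mathcal F^{\xi}u)\big(t-x,-\tfrac{t+x}{2}\big)$, i.e. $\langle\rho(u)\psi,\varphi\rangle=\langle k_u,\varphi\otimes\psi\rangle$ for all $\varphi,\psi\in\mathcal S(\mathbb R^d)$, where $(\varphi\otimes\psi)(t,x)=\varphi(t)\psi(x)$,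 where $\mathcal F^\xi$ is the partial Fourier transform $\mathcal F^\xi f(x,\eta)=\int_{\mathbb R^d} f(x,\xi)e^{-2\pi i\xi\cdot\eta}\,d\xi$, and where $\mathcal F^\xi$ and the linear change of variables are understood in the sense of distributions. For $a\in\mathcal S'(\mathbb R^{2d})$ the Weyl quantization of $a$ is $L_a:=\rho(\mathcal F_\sigma a):\mathcal S(\mathbb R^d)\to\mathcal S'(\mathbb R^d)$. One says that $L_a$ is compact if $L_a$ maps $\mathcal S(\mathbb R^d)$ into $L^2(\mathbb R^d)$, is continuous with respect to the $L^2$-norm, and its continuous extension to $L^2(\mathbb R^d)$ is a compact operator. **Theorem.** Let $u$ be a (complex-valued) distribution on $\mathbb R^{2d}$ with compact support. Then $L_{\mathcal F_\sigma u}$ is compact if and only if $\mathcal F_\sigma u\in C_\infty(\mathbb R^{2d})$, that is, the tempered distribution $\mathcal F_\sigma u$ is given by a continuous function on $\mathbb R^{2d}$ that vanishes at infinity. -/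

import Mathlib

namespace WeylQuantization

open MeasureTheory SchwartzMap Real FourierTransform
open scoped SchwartzMap InnerProductSpace ContDiff FourierTransform ZeroAtInfty

noncomputable section

section PartialFourier
universe u
variable {E F G : Type u} [NormedAddCommGroup E] [NormedSpace ℝ E]
  [NormedAddCommGroup F] [InnerProductSpace ℝ F]
  [NormedAddCommGroup G] [NormedSpace ℂ G]

/-- The partial Fourier transform with respect to the second variable,
`(x, η) ↦ ∫ f(x, ξ) e^{-2πi ξ η} dξ` (here `𝐞 s = e^{2πi s}`). -/
def partialFourierFun [MeasurableSpace F] [BorelSpace F] [FiniteDimensional ℝ F]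
    (f : E × F → G) (z : E × F) : G :=
  ∫ ξ : F, 𝐞 (-⟪ξ, z.2⟫_ℝ) • f (z.1, ξ)

/-- The restriction of a Schwartz function to the slice with fixed first variable. -/
def schwartzSlice (x : E) (f : 𝓢(E × F, G)) : 𝓢(F, G) :=
  compCLMOfAntilipschitz ℂ (K := 1) (g := fun ξ : F => (x, ξ))
    (by
      have h : (fun ξ : F => (x, ξ)) =
          (fun ξ : F => ((x, 0) : E × F) + ContinuousLinearMap.inr ℝ E F ξ) := by
        ext ξ <;> simp
      rw [h]
      exact (Function.HasTemperateGrowth.const _).add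
        (ContinuousLinearMap.inr ℝ E F).hasTemperateGrowth)
    (AntilipschitzWith.of_le_mul_dist fun a b => by simp [Prod.dist_eq]) f

lemma schwartzSlice_apply (x : E) (f : 𝓢(E × F, G)) (ξ : F) :
    schwartzSlice x f ξ = f (x, ξ) := rfl

lemma norm_iteratedFDeriv_schwartzSlice_le (x : E) (f : 𝓢(E × F, G)) (n : ℕ) (ξ : F) :
    ‖iteratedFDeriv ℝ n (schwartzSlice x f) ξ‖ ≤ ‖iteratedFDeriv ℝ n f (x, ξ)‖ := by
  have h1 : (schwartzSlice x f : F → G) =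
      (fun w : E × F => f ((x, 0) + w)) ∘ (ContinuousLinearMap.inr ℝ E F) := by
    ext ξ; simp [schwartzSlice_apply]
  have hs : ContDiff ℝ ∞ (fun w : E × F => f ((x, 0) + w)) :=
    (f.smooth ⊤).comp (contDiff_const.add contDiff_id)
  rw [h1, ContinuousLinearMap.iteratedFDeriv_comp_right _ hs _ (mod_cast le_top),
    iteratedFDeriv_comp_add_left]
  refine (ContinuousMultilinearMap.norm_compContinuousLinearMap_le _ _).trans ?_
  simp only [ContinuousLinearMap.inr_apply, Prod.mk_add_mk, add_zero, zero_add, Finset.prod_const]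
  refine mul_le_of_le_one_right (norm_nonneg _) (pow_le_one₀ (norm_nonneg _) ?_)
  exact ContinuousLinearMap.norm_inr_le_one ℝ E F

lemma seminorm_schwartzSlice_le (x : E) (f : 𝓢(E × F, G)) (k n : ℕ) :
    SchwartzMap.seminorm ℂ k n (schwartzSlice x f) ≤ SchwartzMap.seminorm ℂ k n f := by
  refine SchwartzMap.seminorm_le_bound ℂ k n _ (by positivity) fun ξ => ?_
  refine le_trans ?_ (SchwartzMap.le_seminorm ℂ k n f (x, ξ))
  gcongr
  · exact norm_snd_le (x, ξ)
  · exact norm_iteratedFDeriv_schwartzSlice_le x f n ξ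

/-- Precomposition with `(x, y) ↦ (x, 0)`, as a complex linear map. -/
def restrictFst : ((E × F) →L[ℝ] G) →L[ℂ] ((E × F) →L[ℝ] G) where
  toFun A := A.comp ((ContinuousLinearMap.inl ℝ E F).comp (ContinuousLinearMap.fst ℝ E F))
  map_add' A B := by ext <;> simp
  map_smul' A B := by ext <;> simp
  cont := ((ContinuousLinearMap.compL ℝ (E × F) (E × F) G).flip
      ((ContinuousLinearMap.inl ℝ E F).comp (ContinuousLinearMap.fst ℝ E F))).continuous

lemma restrictFst_apply (A : (E × F) →L[ℝ] G) (v : E × F) : restrictFst A v = A (v.1, 0) := rfl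

/-- The Schwartz function whose partial Fourier transform is the derivative of the partial Fourier
transform. -/
def partialFourierDeriv : 𝓢(E × F, G) →L[ℂ] 𝓢(E × F, (E × F) →L[ℝ] G) :=
  SchwartzMap.postcompCLM (restrictFst (E := E) (F := F) (G := G)) ∘L
    SchwartzMap.fderivCLM ℂ (E × F) G
  - (2 * π * Complex.I) • SchwartzMap.smulRightCLM ℂ G ((innerSL ℝ).bilinearComp
      (ContinuousLinearMap.snd ℝ E F) (ContinuousLinearMap.snd ℝ E F))

lemma partialFourierDeriv_apply (f : 𝓢(E × F, G)) (z v : E × F) :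
    partialFourierDeriv f z v =
      fderiv ℝ f z (v.1, 0) - (2 * π * Complex.I) • ⟪z.2, v.2⟫_ℝ • f z := by
  simp [partialFourierDeriv, restrictFst_apply, innerSL_apply_apply]

lemma hasFDerivAt_partialFourier_integrand (f : 𝓢(E × F, G)) (ξ : F) (w : E × F) :
    HasFDerivAt (fun w : E × F => 𝐞 (-⟪ξ, w.2⟫_ℝ) • f (w.1, ξ))
      (𝐞 (-⟪ξ, w.2⟫_ℝ) • partialFourierDeriv f (w.1, ξ)) w := by
  have h1 : HasFDerivAt (fun w : E × F => (𝐞 (-⟪ξ, w.2⟫_ℝ) : ℂ)) _ w :=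
    (Real.hasFDerivAt_fourierChar_neg_bilinear_right (innerSL ℝ) ξ w.2).comp w
      (hasFDerivAt_snd (𝕜 := ℝ))
  have h3 : HasFDerivAt (fun w : E × F => (w.1, ξ)) ((ContinuousLinearMap.inl ℝ E F).comp
      (ContinuousLinearMap.fst ℝ E F)) w :=
    (hasFDerivAt_prodMk_left (𝕜 := ℝ) w.1 ξ).comp w (hasFDerivAt_fst (𝕜 := ℝ))
  have h2 : HasFDerivAt (fun w : E × F => f (w.1, ξ))
      ((fderiv ℝ f (w.1, ξ)).comp ((ContinuousLinearMap.inl ℝ E F).comp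
        (ContinuousLinearMap.fst ℝ E F))) w :=
    ((f.differentiableAt (x := (w.1, ξ))).hasFDerivAt).comp w h3
  refine (h1.smul h2).congr_fderiv ?_
  refine ContinuousLinearMap.ext fun v => ?_
  rw [add_apply, Circle.smul_def, smul_apply, smul_apply,
    partialFourierDeriv_apply, smul_sub, sub_eq_add_neg]
  congr 1
  simp only [ContinuousLinearMap.smulRight_apply, ContinuousLinearMap.comp_apply,
    smul_apply, ContinuousLinearMap.coe_snd',
    Complex.ofRealCLM_apply, smul_eq_mul]
  rw [← Complex.coe_smul, smul_smul, smul_smul, ← neg_smul]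
  congr 1
  have e : (innerSL ℝ ξ) w.2 = ⟪ξ, w.2⟫_ℝ := rfl
  have e' : (innerSL ℝ ξ) v.2 = ⟪ξ, v.2⟫_ℝ := rfl
  rw [e, e']
  ring

variable [MeasurableSpace F] [BorelSpace F] [FiniteDimensional ℝ F]

lemma partialFourierFun_eq (f : 𝓢(E × F, G)) (z : E × F) :
    partialFourierFun f z = 𝓕 (schwartzSlice z.1 f) z.2 := by
  rw [SchwartzMap.fourier_coe, Real.fourier_eq]; rfl

lemma integrable_partialFourier (f : 𝓢(E × F, G)) (z : E × F) :
    Integrable fun ξ : F => 𝐞 (-⟪ξ, z.2⟫_ℝ) • f (z.1, ξ) :=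
  (Real.fourierIntegral_convergent_iff z.2).2 (schwartzSlice z.1 f).integrable

lemma slice_decay (f : 𝓢(E × F, G)) (k : ℕ) (x : E) (ξ : F) :
    ‖x‖ ^ k * ‖f (x, ξ)‖ ≤
      2 ^ (k + (volume : Measure F).integrablePower) *
        (Finset.Iic (k + (volume : Measure F).integrablePower, 0)).sup
          (schwartzSeminormFamily ℂ (E × F) G) f *
        (1 + ‖ξ‖) ^ (-((volume : Measure F).integrablePower : ℝ)) := by
  have h := SchwartzMap.one_add_le_sup_seminorm_apply (𝕜 := ℂ)
    (m := (k + (volume : Measure F).integrablePower, 0)) le_rfl le_rfl f (x, ξ)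
  rw [norm_iteratedFDeriv_zero] at h
  rw [Real.rpow_neg (by positivity), Real.rpow_natCast, ← div_eq_mul_inv,
    le_div_iff₀ (by positivity)]
  refine le_trans ?_ h
  have h1 : ‖x‖ ≤ 1 + ‖(x, ξ)‖ := (norm_fst_le (x, ξ)).trans (by simp)
  have h2 : ‖ξ‖ ≤ ‖(x, ξ)‖ := norm_snd_le (x, ξ)
  rw [pow_add, mul_right_comm]
  gcongr

lemma exists_bound_partialFourier (f : 𝓢(E × F, G)) :
    ∃ C : ℝ, ∀ (w : E × F) (ξ : F), ‖𝐞 (-⟪ξ, w.2⟫_ℝ) • f (w.1, ξ)‖ ≤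
      C * (1 + ‖ξ‖) ^ (-((volume : Measure F).integrablePower : ℝ)) := by
  refine ⟨2 ^ (0 + (volume : Measure F).integrablePower) *
        (Finset.Iic (0 + (volume : Measure F).integrablePower, 0)).sup
          (schwartzSeminormFamily ℂ (E × F) G) f, fun w ξ => ?_⟩
  have h := slice_decay f 0 w.1 ξ
  rw [pow_zero, one_mul] at h
  rw [Circle.norm_smul]
  exact h

lemma aestronglyMeasurable_circle_smul {W : Type*} [NormedAddCommGroup W] [NormedSpace ℝ W]
    {c : F → ℝ} (hc : Continuous c) {g : F → W →L[ℝ] G} (hg : Continuous g) :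
    AEStronglyMeasurable (fun ξ => 𝐞 (c ξ) • g ξ) (volume : Measure F) :=
  ((Real.continuous_fourierChar.comp hc).smul hg).aestronglyMeasurable

lemma hasFDerivAt_partialFourierFun (f : 𝓢(E × F, G)) (z : E × F) :
    HasFDerivAt (partialFourierFun f) (partialFourierFun (partialFourierDeriv f) z) z := by
  obtain ⟨C, hle⟩ := exists_bound_partialFourier (G := (E × F) →L[ℝ] G) (partialFourierDeriv f)
  have hb : Integrable (fun ξ : F =>
      C * (1 + ‖ξ‖) ^ (-((volume : Measure F).integrablePower : ℝ))) :=
    ((volume : Measure F).integrable_pow_neg_integrablePower).const_mul C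
  let I : E × F → F → G := fun w ξ => 𝐞 (-⟪ξ, w.2⟫_ℝ) • f (w.1, ξ)
  let I' : E × F → F → (E × F) →L[ℝ] G := fun w ξ =>
    𝐞 (-⟪ξ, w.2⟫_ℝ) • partialFourierDeriv f (w.1, ξ)
  have h0 (w : E × F) : Integrable (I w) := integrable_partialFourier f w
  have h1 : ∀ᶠ w in nhds z, AEStronglyMeasurable (I w) :=
    Filter.Eventually.of_forall fun w => (h0 w).aestronglyMeasurable
  have h3 : AEStronglyMeasurable (I' z) :=
    aestronglyMeasurable_circle_smul (W := E × F) (by fun_prop)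
      ((partialFourierDeriv f).continuous.comp (Continuous.prodMk_right z.1))
  have h6 : ∀ᵐ ξ : F, ∀ w, w ∈ (Set.univ : Set (E × F)) →
      HasFDerivAt (fun x => I x ξ) (I' w ξ) w :=
    Filter.Eventually.of_forall fun ξ w _ => hasFDerivAt_partialFourier_integrand f ξ w
  have h7 : HasFDerivAt (fun w => ∫ ξ, I w ξ) (∫ ξ, I' z ξ) z :=
    hasFDerivAt_integral_of_dominated_of_fderiv_le (𝕜 := ℝ) Filter.univ_mem h1 (h0 z) h3
      (Filter.Eventually.of_forall fun ξ w _ => hle w ξ) hb h6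
  exact h7

lemma contDiff_partialFourierFun (n : ℕ) {G : Type u} [NormedAddCommGroup G] [NormedSpace ℂ G]
    (f : 𝓢(E × F, G)) : ContDiff ℝ n (partialFourierFun f) := by
  induction n generalizing G with
  | zero =>
    exact contDiff_zero.2 (Differentiable.continuous (𝕜 := ℝ)
      fun z => (hasFDerivAt_partialFourierFun f z).differentiableAt)
  | succ n ih =>
    have h : fderiv ℝ (partialFourierFun f) = partialFourierFun (partialFourierDeriv f) :=
      funext fun z => (hasFDerivAt_partialFourierFun f z).fderiv
    push_cast
    rw [contDiff_succ_iff_fderiv, h]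
    exact ⟨fun z => (hasFDerivAt_partialFourierFun f z).differentiableAt, by simp, ih _⟩

lemma continuous_schwartz_finset_sup {V W : Type*} [NormedAddCommGroup V] [NormedSpace ℝ V]
    [NormedAddCommGroup W] [NormedSpace ℂ W] (s : Finset (ℕ × ℕ)) :
    Continuous (s.sup (schwartzSeminormFamily ℂ V W) : Seminorm ℂ 𝓢(V, W)) := by
  refine Finset.sup_induction (p := fun q : Seminorm ℂ 𝓢(V, W) => Continuous q) ?_ ?_ ?_
  · exact continuous_const
  · intro p hp q hq
    exact hp.max hq
  · intro i _
    exact (schwartz_withSeminorms ℂ V W).continuous_seminorm i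

lemma partialFourierFun_decay (k n : ℕ) {G : Type u} [NormedAddCommGroup G] [NormedSpace ℂ G] :
    ∃ (s : Finset (ℕ × ℕ)) (C : ℝ), 0 ≤ C ∧ ∀ (f : 𝓢(E × F, G)) (z : E × F),
      ‖z‖ ^ k * ‖iteratedFDeriv ℝ n (partialFourierFun f) z‖ ≤
        C * s.sup (schwartzSeminormFamily ℂ (E × F) G) f := by
  induction n generalizing G with
  | zero =>
    set N := (volume : Measure F).integrablePower with hN
    obtain ⟨s, C, -, hC⟩ := Seminorm.bound_of_continuous (schwartz_withSeminorms ℂ F G)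
      ((schwartzSeminormFamily ℂ F G (k, 0)).comp (FourierTransform.fourierCLM ℂ 𝓢(F, G)).toLinearMap)
      (((schwartz_withSeminorms ℂ F G).continuous_seminorm (k, 0)).comp
        (FourierTransform.fourierCLM ℂ 𝓢(F, G)).continuous)
    refine ⟨s ∪ Finset.Iic (k + N, 0),
      C + 2 ^ (k + N) * ∫ ξ : F, (1 + ‖ξ‖) ^ (-(N : ℝ)), by positivity, fun f z => ?_⟩
    rw [norm_iteratedFDeriv_zero]
    have hz : ‖z‖ ^ k ≤ ‖z.2‖ ^ k + ‖z.1‖ ^ k := by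
      rcases le_total ‖z.1‖ ‖z.2‖ with h | h
      · rw [Prod.norm_def, max_eq_right h]; simp
      · rw [Prod.norm_def, max_eq_left h]; simp
    have h1 : ‖z.2‖ ^ k * ‖partialFourierFun f z‖ ≤
        C * s.sup (schwartzSeminormFamily ℂ (E × F) G) f := by
      rw [partialFourierFun_eq]
      refine (SchwartzMap.norm_pow_mul_le_seminorm ℂ _ k z.2).trans ?_
      refine (hC (schwartzSlice z.1 f)).trans ?_
      simp only [smul_apply, NNReal.smul_def, smul_eq_mul]
      gcongr
      refine Seminorm.finset_sup_apply_le (by positivity) fun i hi => ?_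
      exact (seminorm_schwartzSlice_le z.1 f i.1 i.2).trans
        (Seminorm.le_finset_sup_apply (p := schwartzSeminormFamily ℂ (E × F) G) hi)
    have h2 : ‖z.1‖ ^ k * ‖partialFourierFun f z‖ ≤
        (2 ^ (k + N) * ∫ ξ : F, (1 + ‖ξ‖) ^ (-(N : ℝ))) *
          (Finset.Iic (k + N, 0)).sup (schwartzSeminormFamily ℂ (E × F) G) f := by
      calc ‖z.1‖ ^ k * ‖partialFourierFun f z‖
          ≤ ‖z.1‖ ^ k * ∫ ξ : F, ‖f (z.1, ξ)‖ := by
            gcongr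
            refine (norm_integral_le_integral_norm _).trans_eq ?_
            simp only [Circle.norm_smul]
        _ = ∫ ξ : F, ‖z.1‖ ^ k * ‖f (z.1, ξ)‖ := (integral_const_mul _ _).symm
        _ ≤ ∫ ξ : F, 2 ^ (k + N) *
              (Finset.Iic (k + N, 0)).sup (schwartzSeminormFamily ℂ (E × F) G) f *
              (1 + ‖ξ‖) ^ (-(N : ℝ)) := by
            refine integral_mono ((schwartzSlice z.1 f).integrable.norm.const_mul _)
              (((volume : Measure F).integrable_pow_neg_integrablePower).const_mul _)
              fun ξ => slice_decay f k z.1 ξ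
        _ = _ := by rw [integral_const_mul]; ring
    have m1 : s.sup (schwartzSeminormFamily ℂ (E × F) G) f ≤
        (s ∪ Finset.Iic (k + N, 0)).sup (schwartzSeminormFamily ℂ (E × F) G) f :=
      Seminorm.le_def.1 (Finset.sup_mono Finset.subset_union_left) f
    have m2 : (Finset.Iic (k + N, 0)).sup (schwartzSeminormFamily ℂ (E × F) G) f ≤
        (s ∪ Finset.Iic (k + N, 0)).sup (schwartzSeminormFamily ℂ (E × F) G) f :=
      Seminorm.le_def.1 (Finset.sup_mono Finset.subset_union_right) f
    calc ‖z‖ ^ k * ‖partialFourierFun f z‖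
        ≤ (‖z.2‖ ^ k + ‖z.1‖ ^ k) * ‖partialFourierFun f z‖ := by gcongr
      _ = ‖z.2‖ ^ k * ‖partialFourierFun f z‖ + ‖z.1‖ ^ k * ‖partialFourierFun f z‖ := add_mul ..
      _ ≤ _ := add_le_add h1 h2
      _ ≤ _ := by rw [add_mul]; gcongr
  | succ n ih =>
    obtain ⟨s, C, hC0, hC⟩ := ih (G := (E × F) →L[ℝ] G)
    obtain ⟨t, D, -, hD⟩ := Seminorm.bound_of_continuous (schwartz_withSeminorms ℂ (E × F) G)
      ((s.sup (schwartzSeminormFamily ℂ (E × F) ((E × F) →L[ℝ] G))).comp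
        (partialFourierDeriv (E := E) (F := F) (G := G)).toLinearMap)
      ((continuous_schwartz_finset_sup s).comp
        (partialFourierDeriv (E := E) (F := F) (G := G)).continuous)
    refine ⟨t, C * D, by positivity, fun f z => ?_⟩
    have h : fderiv ℝ (partialFourierFun f) = partialFourierFun (partialFourierDeriv f) :=
      funext fun z => (hasFDerivAt_partialFourierFun f z).fderiv
    rw [← norm_iteratedFDeriv_fderiv, h, mul_assoc]
    refine (hC (partialFourierDeriv f) z).trans ?_
    gcongr
    exact hD f

/-- The partial Fourier transform as an operator on Schwartz functions. -/
def partialFourier : 𝓢(E × F, G) →L[ℂ] 𝓢(E × F, G) :=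
  SchwartzMap.mkCLM (fun f => partialFourierFun f)
    (fun f g z => by
      simp only [partialFourierFun, add_apply, smul_add]
      exact integral_add (integrable_partialFourier f z) (integrable_partialFourier g z))
    (fun a f z => by
      simp only [partialFourierFun, smul_apply, RingHom.id_apply]
      rw [← integral_smul]
      refine integral_congr_ae (Filter.Eventually.of_forall fun ξ => ?_)
      exact smul_comm _ _ _)
    (fun f => contDiff_infty.2 fun n => contDiff_partialFourierFun n f)
    (fun n => partialFourierFun_decay n.1 n.2)

lemma partialFourier_apply (f : 𝓢(E × F, G)) (z : E × F) :
    partialFourier f z = ∫ ξ : F, 𝐞 (-⟪ξ, z.2⟫_ℝ) • f (z.1, ξ) := rfl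

end PartialFourier

section Tensor
variable {E F : Type*} [NormedAddCommGroup E] [NormedSpace ℝ E]
  [NormedAddCommGroup F] [NormedSpace ℝ F]

lemma norm_iteratedFDeriv_comp_fst_le (φ : 𝓢(E, ℂ)) (n : ℕ) (z : E × F) :
    ‖iteratedFDeriv ℝ n (fun z : E × F => φ z.1) z‖ ≤ ‖iteratedFDeriv ℝ n φ z.1‖ := by
  have h := ContinuousLinearMap.iteratedFDeriv_comp_right (ContinuousLinearMap.fst ℝ E F)
    (φ.smooth ⊤) z (i := n) (mod_cast le_top)
  have e : (fun z : E × F => φ z.1) = φ ∘ (ContinuousLinearMap.fst ℝ E F) := rfl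
  rw [e, h]
  refine (ContinuousMultilinearMap.norm_compContinuousLinearMap_le _ _).trans ?_
  rw [Finset.prod_const]
  exact mul_le_of_le_one_right (norm_nonneg _)
    (pow_le_one₀ (norm_nonneg _) (ContinuousLinearMap.norm_fst_le ℝ E F))

lemma norm_iteratedFDeriv_comp_snd_le (ψ : 𝓢(F, ℂ)) (n : ℕ) (z : E × F) :
    ‖iteratedFDeriv ℝ n (fun z : E × F => ψ z.2) z‖ ≤ ‖iteratedFDeriv ℝ n ψ z.2‖ := by
  have h := ContinuousLinearMap.iteratedFDeriv_comp_right (ContinuousLinearMap.snd ℝ E F)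
    (ψ.smooth ⊤) z (i := n) (mod_cast le_top)
  have e : (fun z : E × F => ψ z.2) = ψ ∘ (ContinuousLinearMap.snd ℝ E F) := rfl
  rw [e, h]
  refine (ContinuousMultilinearMap.norm_compContinuousLinearMap_le _ _).trans ?_
  rw [Finset.prod_const]
  exact mul_le_of_le_one_right (norm_nonneg _)
    (pow_le_one₀ (norm_nonneg _) (ContinuousLinearMap.norm_snd_le ℝ E F))

lemma contDiff_tensor (φ : 𝓢(E, ℂ)) (ψ : 𝓢(F, ℂ)) :
    ContDiff ℝ ∞ (fun z : E × F => φ z.1 * ψ z.2) :=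
  ((φ.smooth ⊤).comp contDiff_fst).mul ((ψ.smooth ⊤).comp contDiff_snd)

lemma tensor_decay (φ : 𝓢(E, ℂ)) (k n : ℕ) (ψ : 𝓢(F, ℂ)) (z : E × F) :
    ‖z‖ ^ k * ‖iteratedFDeriv ℝ n (fun z : E × F => φ z.1 * ψ z.2) z‖ ≤
      (∑ i ∈ Finset.range (n + 1), (n.choose i : ℝ) *
        (SchwartzMap.seminorm ℂ k i φ + SchwartzMap.seminorm ℂ 0 i φ)) *
          (Finset.Iic (k, n)).sup (schwartzSeminormFamily ℂ F ℂ) ψ := by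
  have h := norm_iteratedFDeriv_mul_le (𝕜 := ℝ) (n := n) (N := ∞)
    (f := fun z : E × F => φ z.1) (g := fun z : E × F => ψ z.2)
    ((φ.smooth ⊤).comp contDiff_fst) ((ψ.smooth ⊤).comp contDiff_snd) z (mod_cast le_top)
  have hz : ‖z‖ ^ k ≤ ‖z.1‖ ^ k + ‖z.2‖ ^ k := by
    rcases le_total ‖z.1‖ ‖z.2‖ with h | h
    · rw [Prod.norm_def, max_eq_right h]; simp
    · rw [Prod.norm_def, max_eq_left h]; simp
  refine (mul_le_mul_of_nonneg_left h (by positivity)).trans ?_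
  rw [Finset.mul_sum, Finset.sum_mul]
  refine Finset.sum_le_sum fun i hi => ?_
  have hi' : i ≤ n := Nat.lt_succ_iff.1 (Finset.mem_range.1 hi)
  have hs (a : ℕ) (ha : a ≤ k) : SchwartzMap.seminorm ℂ a (n - i) ψ ≤
      (Finset.Iic (k, n)).sup (schwartzSeminormFamily ℂ F ℂ) ψ :=
    Seminorm.le_finset_sup_apply (p := schwartzSeminormFamily ℂ F ℂ) (i := (a, n - i))
      (Finset.mem_Iic.2 ⟨ha, Nat.sub_le _ _⟩)
  set S := (Finset.Iic (k, n)).sup (schwartzSeminormFamily ℂ F ℂ) ψ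
  have a1 := SchwartzMap.le_seminorm ℂ k i φ z.1
  have a2 := SchwartzMap.norm_iteratedFDeriv_le_seminorm ℂ φ i z.1
  have b1 := (SchwartzMap.le_seminorm ℂ k (n - i) ψ z.2).trans (hs k le_rfl)
  have b2 := (SchwartzMap.norm_iteratedFDeriv_le_seminorm ℂ ψ (n - i) z.2).trans
    (hs 0 (Nat.zero_le _))
  calc ‖z‖ ^ k * ((n.choose i : ℝ) * ‖iteratedFDeriv ℝ i (fun z : E × F => φ z.1) z‖ *
        ‖iteratedFDeriv ℝ (n - i) (fun z : E × F => ψ z.2) z‖)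
      ≤ (‖z.1‖ ^ k + ‖z.2‖ ^ k) * ((n.choose i : ℝ) * ‖iteratedFDeriv ℝ i φ z.1‖ *
        ‖iteratedFDeriv ℝ (n - i) ψ z.2‖) := by
        gcongr
        · exact norm_iteratedFDeriv_comp_fst_le φ i z
        · exact norm_iteratedFDeriv_comp_snd_le ψ (n - i) z
    _ = (n.choose i : ℝ) * ((‖z.1‖ ^ k * ‖iteratedFDeriv ℝ i φ z.1‖) *
          ‖iteratedFDeriv ℝ (n - i) ψ z.2‖ + ‖iteratedFDeriv ℝ i φ z.1‖ *
          (‖z.2‖ ^ k * ‖iteratedFDeriv ℝ (n - i) ψ z.2‖)) := by ring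
    _ ≤ (n.choose i : ℝ) * (SchwartzMap.seminorm ℂ k i φ * S +
          SchwartzMap.seminorm ℂ 0 i φ * S) := by
        gcongr
    _ = _ := by ring

/-- The map `ψ ↦ φ ⊗ ψ`, where `(φ ⊗ ψ)(t, x) = φ t * ψ x`. -/
def tensorRight (φ : 𝓢(E, ℂ)) : 𝓢(F, ℂ) →L[ℂ] 𝓢(E × F, ℂ) :=
  SchwartzMap.mkCLM (fun ψ z => φ z.1 * ψ z.2)
    (fun ψ₁ ψ₂ z => by simp [mul_add])
    (fun a ψ z => by simp [mul_left_comm])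
    (fun ψ => contDiff_tensor φ ψ)
    (fun n => ⟨_, _, by positivity, fun ψ z => tensor_decay φ n.1 n.2 ψ z⟩)

/-- The map `φ ↦ φ ⊗ ψ`, where `(φ ⊗ ψ)(t, x) = φ t * ψ x`. -/
def tensorLeft (ψ : 𝓢(F, ℂ)) : 𝓢(E, ℂ) →L[ℂ] 𝓢(E × F, ℂ) :=
  SchwartzMap.compCLMOfContinuousLinearEquiv ℂ (ContinuousLinearEquiv.prodComm ℝ E F) ∘L
    tensorRight ψ

/-- The tensor product `(φ ⊗ ψ)(t, x) = φ t * ψ x` of two Schwartz functions. -/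
def tensor (φ : 𝓢(E, ℂ)) (ψ : 𝓢(F, ℂ)) : 𝓢(E × F, ℂ) := tensorRight φ ψ

lemma tensor_apply (φ : 𝓢(E, ℂ)) (ψ : 𝓢(F, ℂ)) (z : E × F) :
    tensor φ ψ z = φ z.1 * ψ z.2 := rfl

lemma tensorLeft_eq (φ : 𝓢(E, ℂ)) (ψ : 𝓢(F, ℂ)) : tensorLeft ψ φ = tensor φ ψ := by
  ext z
  exact mul_comm (ψ z.2) (φ z.1)

/-- The continuous linear operator `𝓢(F) → 𝓢'(E)` with Schwartz kernel `K`, that is,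
`⟨T ψ, φ⟩ = ⟨K, φ ⊗ ψ⟩`. -/
def kernelOp (K : 𝓢'(E × F, ℂ)) : 𝓢(F, ℂ) →L[ℂ] 𝓢'(E, ℂ) where
  toFun ψ := ContinuousLinearMap.toPointwiseConvergenceCLM _ _ _ _
    ((K : 𝓢(E × F, ℂ) →L[ℂ] ℂ) ∘L tensorLeft ψ)
  map_add' ψ₁ ψ₂ := by
    ext φ
    change K (tensorLeft (ψ₁ + ψ₂) φ) = K (tensorLeft ψ₁ φ) + K (tensorLeft ψ₂ φ)
    simp only [tensorLeft_eq, tensor, map_add]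
  map_smul' a ψ := by
    ext φ
    change K (tensorLeft (a • ψ) φ) = a • K (tensorLeft ψ φ)
    simp only [tensorLeft_eq, tensor, map_smul]
  cont := by
    refine PointwiseConvergenceCLM.continuous_of_continuous_eval fun φ => ?_
    change Continuous fun ψ => K (tensorLeft ψ φ)
    simp only [tensorLeft_eq]
    exact K.continuous.comp (tensorRight φ).continuous

lemma kernelOp_apply (K : 𝓢'(E × F, ℂ)) (ψ : 𝓢(F, ℂ)) (φ : 𝓢(E, ℂ)) :
    kernelOp K ψ φ = K (tensor φ ψ) := by
  rw [← tensorLeft_eq]; rfl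

end Tensor

section Weyl

/-- Configuration space `ℝ^d`. -/
abbrev Config (d : ℕ) : Type := EuclideanSpace ℝ (Fin d)

/-- Phase space `ℝ^{2d} = ℝ^d × ℝ^d`, with coordinates `z = (x, ξ)`. -/
abbrev PhaseSpace (d : ℕ) : Type := Config d × Config d

variable {d : ℕ}

/-- The symplectic form `σ((x, ξ), (x', ξ')) = x' ξ - x ξ'`. -/
def symplecticForm (w z : PhaseSpace d) : ℝ := ⟪z.1, w.2⟫_ℝ - ⟪w.1, z.2⟫_ℝ

/-- The map `(x, ξ) ↦ (ξ, -x)` into phase space with its Euclidean norm; it satisfies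
`⟪z, symplecticRotation w⟫ = σ(w, z)`. -/
def symplecticRotation : PhaseSpace d ≃L[ℝ] WithLp 2 (PhaseSpace d) :=
  ((ContinuousLinearEquiv.prodComm ℝ (Config d) (Config d)).trans
    ((ContinuousLinearEquiv.refl ℝ (Config d)).prodCongr
      (ContinuousLinearEquiv.neg ℝ (M := Config d)))).trans
    (WithLp.prodContinuousLinearEquiv 2 ℝ (Config d) (Config d)).symm

/-- The symplectic Fourier transform on Schwartz functions; see `symplecticFourier_apply` for the
integral formula. -/
def symplecticFourier : 𝓢(PhaseSpace d, ℂ) →L[ℂ] 𝓢(PhaseSpace d, ℂ) :=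
  SchwartzMap.compCLMOfContinuousLinearEquiv ℂ symplecticRotation ∘L
    FourierTransform.fourierCLM ℂ 𝓢(WithLp 2 (PhaseSpace d), ℂ) ∘L
    SchwartzMap.compCLMOfContinuousLinearEquiv ℂ
      (WithLp.prodContinuousLinearEquiv 2 ℝ (Config d) (Config d))

/-- `F_σ f (w) = ∫ f(z) e^{-2πi σ(w, z)} dz`. -/
lemma symplecticFourier_apply (f : 𝓢(PhaseSpace d, ℂ)) (w : PhaseSpace d) :
    symplecticFourier f w = ∫ z : PhaseSpace d, 𝐞 (-symplecticForm w z) • f z := by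
  have h : symplecticFourier f w = ∫ v : WithLp 2 (PhaseSpace d),
      𝐞 (-⟪v, symplecticRotation w⟫_ℝ) • f (WithLp.ofLp v) := rfl
  rw [h, ← (WithLp.volume_preserving_ofLp (Config d) (Config d)).integral_comp
    (MeasurableEquiv.toLp 2 (PhaseSpace d)).symm.measurableEmbedding]
  refine integral_congr_ae (Filter.Eventually.of_forall fun v => ?_)
  have e : ⟪v, symplecticRotation w⟫_ℝ = symplecticForm w (WithLp.ofLp v) := by
    rw [WithLp.prod_inner_apply]
    simp [symplecticRotation, symplecticForm, real_inner_comm, sub_eq_add_neg]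
  simp only [e]

/-- The reflection `f ↦ f(-·)` on Schwartz functions. -/
def reflect : 𝓢(PhaseSpace d, ℂ) →L[ℂ] 𝓢(PhaseSpace d, ℂ) :=
  SchwartzMap.compCLMOfContinuousLinearEquiv ℂ (ContinuousLinearEquiv.neg ℝ (M := PhaseSpace d))

/-- The symplectic Fourier transform on tempered distributions, defined by duality. Because `σ` is
antisymmetric, the transpose of `f ↦ F_σ f` on functions is `φ ↦ (F_σ φ)(-·)`, that is, the operator
`φ ↦ (z ↦ ∫ φ(w) e^{-2πi σ(w, z)} dw)`. -/
def symplecticFourierDistr : 𝓢'(PhaseSpace d, ℂ) →L[ℂ] 𝓢'(PhaseSpace d, ℂ) :=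
  PointwiseConvergenceCLM.precomp ℂ (reflect ∘L symplecticFourier)

lemma symplecticFourierDistr_apply (u : 𝓢'(PhaseSpace d, ℂ)) (φ : 𝓢(PhaseSpace d, ℂ)) :
    symplecticFourierDistr u φ = u (reflect (symplecticFourier φ)) := rfl

/-- The partial Fourier transform in the second variable on tempered distributions, by duality. -/
def partialFourierDistr : 𝓢'(PhaseSpace d, ℂ) →L[ℂ] 𝓢'(PhaseSpace d, ℂ) :=
  PointwiseConvergenceCLM.precomp ℂ partialFourier

/-- The linear change of variables `(t, x) ↦ (t - x, -(t + x) / 2)`. -/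
def kernelCoord : PhaseSpace d ≃L[ℝ] PhaseSpace d :=
  ContinuousLinearEquiv.equivOfInverse
    ((ContinuousLinearMap.fst ℝ (Config d) (Config d) -
        ContinuousLinearMap.snd ℝ (Config d) (Config d)).prod
      (-((1 / 2 : ℝ) • (ContinuousLinearMap.fst ℝ (Config d) (Config d) +
        ContinuousLinearMap.snd ℝ (Config d) (Config d)))))
    (((1 / 2 : ℝ) • ContinuousLinearMap.fst ℝ (Config d) (Config d) -
        ContinuousLinearMap.snd ℝ (Config d) (Config d)).prod
      (-((1 / 2 : ℝ) • ContinuousLinearMap.fst ℝ (Config d) (Config d)) -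
        ContinuousLinearMap.snd ℝ (Config d) (Config d)))
    (fun z => by
      ext i
      · simp; ring
      · simp; ring)
    (fun z => by
      ext i
      · simp; ring
      · simp; ring)

lemma kernelCoord_apply (t x : Config d) :
    kernelCoord (t, x) = (t - x, -((1 / 2 : ℝ) • (t + x))) := rfl

/-- The composition `v ∘ kernelCoord` of a tempered distribution with the linear change of
variables, in the sense of distributions: `⟨v ∘ A, Φ⟩ = |det A|⁻¹ ⟨v, Φ ∘ A⁻¹⟩`, where
`|det A| = 1` for `A = kernelCoord`. -/
def compKernelCoord : 𝓢'(PhaseSpace d, ℂ) →L[ℂ] 𝓢'(PhaseSpace d, ℂ) :=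
  PointwiseConvergenceCLM.precomp ℂ
    (SchwartzMap.compCLMOfContinuousLinearEquiv ℂ (kernelCoord (d := d)).symm)

/-- The kernel `k_u(t, x) = (F^ξ u)(t - x, -(t + x) / 2)`, for a tempered distribution `u`. -/
def rhoKernel (u : 𝓢'(PhaseSpace d, ℂ)) : 𝓢'(PhaseSpace d, ℂ) :=
  compKernelCoord (partialFourierDistr u)

/-- The operator `ρ(u) : 𝓢(ℝ^d) → 𝓢'(ℝ^d)` with Schwartz kernel `k_u`, for a tempered
distribution `u`. It extends the integrated form `∫ F(z) ρ(z) dz` of the projective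
Schrödinger representation `[ρ(x, ξ) g](t) = e^{-πi x ξ + 2πi t ξ} g(t - x)`. -/
def rho (u : 𝓢'(PhaseSpace d, ℂ)) : 𝓢(Config d, ℂ) →L[ℂ] 𝓢'(Config d, ℂ) :=
  kernelOp (rhoKernel u)

/-- The Weyl quantization `L_a = ρ(F_σ a) : 𝓢(ℝ^d) → 𝓢'(ℝ^d)` of a symbol `a ∈ 𝓢'(ℝ^{2d})`. -/
def weylOp (a : 𝓢'(PhaseSpace d, ℂ)) : 𝓢(Config d, ℂ) →L[ℂ] 𝓢'(Config d, ℂ) :=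
  rho (symplecticFourierDistr a)

/-- The operator `A : 𝓢(ℝ^d) → 𝓢'(ℝ^d)` maps into `L²(ℝ^d)`, is continuous for the `L²`-norm, and
its continuous extension to `L²(ℝ^d)` is a compact operator. -/
def IsCompactOnL2 (A : 𝓢(Config d, ℂ) →L[ℂ] 𝓢'(Config d, ℂ)) : Prop :=
  ∃ T : Lp ℂ 2 (volume : Measure (Config d)) →L[ℂ] Lp ℂ 2 (volume : Measure (Config d)),
    IsCompactOperator T ∧
      ∀ ψ : 𝓢(Config d, ℂ), A ψ = Lp.toTemperedDistribution (T (ψ.toLp 2))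

/-- The tempered distribution `v` is (given by integration against) a continuous function which
vanishes at infinity. -/
def VanishesAtInfinity (v : 𝓢'(PhaseSpace d, ℂ)) : Prop :=
  ∃ f : C₀(PhaseSpace d, ℂ), ∀ φ : 𝓢(PhaseSpace d, ℂ), v φ = ∫ z : PhaseSpace d, f z * φ z

end Weyl

end

end WeylQuantization

open WeylQuantization
open scoped SchwartzMap

/-! The two symplectic Fourier transforms in L_{F_σ u} cancel, so the operator in question is ρ(u).
It is tested against the coherent states g_z, the time-frequency shifts of the Gaussian. Let G be
the ambiguity function of the Gaussian, itself a strictly positive Gaussian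
(`exists_gaussianAmbiguity_eq`). The ambiguity function of g_z is e^{-2πiσ(z,·)} G
(`crossAmbiguity_coherent`).

Two formulas follow. For compactly supported u, F_σ(Gu) is the function z ↦ ⟨u, e^{-2πiσ(z,·)} G⟩
(`symplecticFourierDistr_mulDistr_eq_integral`), which is the quadratic form ⟨g_z, ρ(u) g_z⟩ when
ρ(u) is bounded. Dually, if F_σ v is a function f, the Moyal identity turns ρ(Gv) into the
localization operator ∫ f(z) ⟨g_z, ·⟩ g_z dz (`symplecticFourier_gaussianAmbiguity_mul`).

Compact support makes the factor G harmless. If χ is a test function with χu = u, then h = χ/G is a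
test function too, and u = hGu. Multiplying a distribution by a Schwartz function convolves its F_σ
with a Schwartz function, so it keeps F_σ in C₀ (`vanishesAtInfinity_mulDistr`).

If ρ(u) is compact, then ⟨g_z, ρ(u) g_z⟩ tends to 0, because the g_z are bounded and tend weakly to
0 as z goes to infinity. Thus F_σ(Gu) is in C₀, and multiplying Gu by h recovers u. Conversely, if
F_σ u is in C₀, so is f = F_σ(hu), and ρ(u) = ρ(G·hu) is the localization operator with symbol f. It
is the norm limit of its truncations to balls, which are integrals of rank-one operators over
compact sets and hence compact (`exists_isCompactOperator_localization`). -/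

namespace WeylQuantization

open MeasureTheory SchwartzMap Real FourierTransform
open scoped SchwartzMap InnerProductSpace ContDiff FourierTransform ZeroAtInfty

noncomputable section

/-! ### The Gaussian as a Schwartz function. -/

section Gaussian
variable {V : Type*} [NormedAddCommGroup V] [InnerProductSpace ℝ V]

/-- One term of the exponential series bounds the power by m! e^{1+r}, and 1 + r − πr² never exceeds
2. -/
lemma one_add_pow_mul_exp_le (m : ℕ) {r : ℝ} (hr : 0 ≤ r) :
    (1 + r) ^ m * Real.exp (-π * r ^ 2) ≤ m.factorial * Real.exp 2 := by
  have h1 : (1 + r) ^ m ≤ m.factorial * Real.exp (1 + r) := by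
    have := Real.pow_div_factorial_le_exp (1 + r) (by positivity) m
    rwa [div_le_iff₀' (by positivity)] at this
  calc (1 + r) ^ m * Real.exp (-π * r ^ 2)
      ≤ m.factorial * Real.exp (1 + r) * Real.exp (-π * r ^ 2) := by gcongr
    _ = m.factorial * Real.exp (1 + r + -π * r ^ 2) := by rw [mul_assoc, ← Real.exp_add]
    _ ≤ m.factorial * Real.exp 2 := by
      gcongr
      nlinarith [Real.pi_gt_three, sq_nonneg (r - 1), sq_nonneg r]

/-- Faà di Bruno for exp composed with −π‖x‖²: every derivative of exp at that point is the Gaussian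
itself, and the inner function has polynomially bounded derivatives. -/
lemma norm_iteratedFDeriv_gaussian_le (n : ℕ) :
    ∃ (k : ℕ) (C : ℝ), 0 ≤ C ∧ ∀ x : V,
      ‖iteratedFDeriv ℝ n (fun x : V => Real.exp (-π * ‖x‖ ^ 2)) x‖ ≤
        C * (1 + ‖x‖) ^ k * Real.exp (-π * ‖x‖ ^ 2) := by
  have ht : Function.HasTemperateGrowth (fun x : V => -π * ‖x‖ ^ 2) :=
    (Function.HasTemperateGrowth.const (-π)).mul (Function.hasTemperateGrowth_norm_sq V)
  obtain ⟨k, C, hC, h⟩ := ht.norm_iteratedFDeriv_le_uniform n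
  refine ⟨k * n, n.factorial * (1 + C) ^ n, by positivity, fun x => ?_⟩
  have key := norm_iteratedFDeriv_comp_le (𝕜 := ℝ) (n := n) (N := ∞) (g := Real.exp)
    (f := fun x : V => -π * ‖x‖ ^ 2) (C := Real.exp (-π * ‖x‖ ^ 2))
    (D := (1 + C) * (1 + ‖x‖) ^ k) Real.contDiff_exp ht.1 (mod_cast le_top) x
    (fun i _ => by
      rw [norm_iteratedFDeriv_eq_norm_iteratedDeriv, iteratedDeriv_eq_iterate,
        Real.iter_deriv_exp, Real.norm_of_nonneg (Real.exp_pos _).le])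
    (fun i hi hin => by
      refine (h i hin x).trans ?_
      -- The composition bound asks for `D ^ i` with `1 ≤ i`. A bound by `D` suffices once `1 ≤ D`,
      -- whence `1 + C` instead of `C`.
      have h1 : 1 ≤ (1 + C) * (1 + ‖x‖) ^ k :=
        one_le_mul_of_one_le_of_one_le (by linarith)
          (one_le_pow₀ (by linarith [norm_nonneg x]))
      refine le_trans ?_ (le_self_pow₀ h1 (by omega))
      gcongr
      linarith)
  refine key.trans_eq ?_
  rw [mul_pow, ← pow_mul]
  ring

variable (V) in
/-- The Gaussian `x ↦ e^{-π |x|²}` as a real valued Schwartz function. -/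
def realGaussian : 𝓢(V, ℝ) where
  toFun x := Real.exp (-π * ‖x‖ ^ 2)
  smooth' := Real.contDiff_exp.comp (contDiff_const.mul (contDiff_norm_sq ℝ))
  decay' k n := by
    obtain ⟨l, C, hC, h⟩ := norm_iteratedFDeriv_gaussian_le (V := V) n
    refine ⟨C * ((k + l).factorial * Real.exp 2), fun x => ?_⟩
    calc ‖x‖ ^ k * ‖iteratedFDeriv ℝ n (fun x : V => Real.exp (-π * ‖x‖ ^ 2)) x‖
        ≤ (1 + ‖x‖) ^ k * (C * (1 + ‖x‖) ^ l * Real.exp (-π * ‖x‖ ^ 2)) := by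
          gcongr
          · simp
          · exact h x
      _ = C * ((1 + ‖x‖) ^ (k + l) * Real.exp (-π * ‖x‖ ^ 2)) := by rw [pow_add]; ring
      _ ≤ _ := by
          exact mul_le_mul_of_nonneg_left (one_add_pow_mul_exp_le _ (norm_nonneg x)) hC

variable (V) in
/-- The Gaussian `x ↦ e^{-π |x|²}`. -/
def gaussian : 𝓢(V, ℂ) := SchwartzMap.postcompCLM Complex.ofRealCLM (realGaussian V)

lemma gaussian_apply (x : V) : gaussian V x = Complex.exp (-π * ‖x‖ ^ 2) := by
  change ((Real.exp (-π * ‖x‖ ^ 2) : ℝ) : ℂ) = _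
  push_cast
  rfl

lemma gaussian_conj (x : V) : (starRingEnd ℂ) (gaussian V x) = gaussian V x :=
  Complex.conj_ofReal _

end Gaussian

/-! ### Conjugation and multiplication by Schwartz functions. -/

section Operations
variable {E : Type*} [NormedAddCommGroup E] [NormedSpace ℝ E]

/-- The complex conjugate of a Schwartz function. -/
def conj (φ : 𝓢(E, ℂ)) : 𝓢(E, ℂ) :=
  SchwartzMap.postcompCLM (𝕜 := ℝ) (Complex.conjCLE : ℂ →L[ℝ] ℂ) φ

@[simp]
lemma conj_apply (φ : 𝓢(E, ℂ)) (x : E) : conj φ x = (starRingEnd ℂ) (φ x) := rfl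

lemma conj_conj (φ : 𝓢(E, ℂ)) : conj (conj φ) = φ := by
  ext x; simp

/-- Multiplication by a fixed Schwartz function. -/
def mulS (h : 𝓢(E, ℂ)) : 𝓢(E, ℂ) →L[ℂ] 𝓢(E, ℂ) := SchwartzMap.smulLeftCLM ℂ h

@[simp]
lemma mulS_apply (h φ : 𝓢(E, ℂ)) (x : E) : mulS h φ x = h x * φ x :=
  SchwartzMap.smulLeftCLM_apply_apply h.hasTemperateGrowth φ x

lemma mulS_comm (h φ : 𝓢(E, ℂ)) : mulS h φ = mulS φ h := by
  ext x; simp [mul_comm]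

lemma mulS_mulS (h k φ : 𝓢(E, ℂ)) : mulS h (mulS k φ) = mulS (mulS h k) φ := by
  ext x; simp [mul_assoc]

/-- The product of a tempered distribution with a Schwartz function. -/
def mulDistr (h : 𝓢(E, ℂ)) (u : 𝓢'(E, ℂ)) : 𝓢'(E, ℂ) :=
  PointwiseConvergenceCLM.precomp ℂ (mulS h) u

@[simp]
lemma mulDistr_apply (h : 𝓢(E, ℂ)) (u : 𝓢'(E, ℂ)) (φ : 𝓢(E, ℂ)) :
    mulDistr h u φ = u (mulS h φ) := rfl

lemma norm_toLp_two_sq [MeasurableSpace E] [BorelSpace E] [FiniteDimensional ℝ E]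
    {μ : Measure E} [μ.HasTemperateGrowth]
    (φ : 𝓢(E, ℂ)) : ‖φ.toLp 2 μ‖ ^ 2 = ∫ x, ‖φ x‖ ^ 2 ∂μ := by
  have h := inner_self_eq_norm_sq_to_K (𝕜 := ℂ) (φ.toLp 2 μ)
  rw [inner_toL2_toL2_eq φ φ μ] at h
  simp_rw [inner_self_eq_norm_sq_to_K] at h
  have h2 : ∫ x, ((‖φ x‖ : ℂ)) ^ 2 ∂μ = ((∫ x, ‖φ x‖ ^ 2 ∂μ : ℝ) : ℂ) := by
    rw [← integral_complex_ofReal]; push_cast; rfl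
  have h3 : ((‖φ.toLp 2 μ‖ ^ 2 : ℝ) : ℂ) = ((∫ x, ‖φ x‖ ^ 2 ∂μ : ℝ) : ℂ) := by
    rw [← h2]; push_cast; exact h.symm
  exact_mod_cast h3

end Operations

/-! ### The symplectic Fourier transform is an involution. -/

section SymplecticFourier
variable {d : ℕ}

instance isAddHaarMeasure_phaseSpace : (volume : Measure (PhaseSpace d)).IsAddHaarMeasure :=
  Measure.prod.instIsAddHaarMeasure volume volume

instance isNegInvariant_phaseSpace : (volume : Measure (PhaseSpace d)).IsNegInvariant :=
  ⟨((Measure.measurePreserving_neg (volume : Measure (Config d))).prod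
    (Measure.measurePreserving_neg (volume : Measure (Config d)))).map_eq⟩

lemma symplecticForm_swap (w z : PhaseSpace d) : symplecticForm w z = -symplecticForm z w := by
  simp only [symplecticForm]
  ring

lemma symplecticForm_sub_left (w w' z : PhaseSpace d) :
    symplecticForm (w - w') z = symplecticForm w z - symplecticForm w' z := by
  simp only [symplecticForm, Prod.fst_sub, Prod.snd_sub, inner_sub_left, inner_sub_right]
  ring

lemma symplecticForm_neg_left (w z : PhaseSpace d) :
    symplecticForm (-w) z = -symplecticForm w z := by
  simp only [symplecticForm, Prod.fst_neg, Prod.snd_neg, inner_neg_left, inner_neg_right]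
  ring

lemma symplecticForm_neg_right (w z : PhaseSpace d) :
    symplecticForm w (-z) = -symplecticForm w z := by
  rw [symplecticForm_swap, symplecticForm_neg_left, symplecticForm_swap z w, neg_neg]

lemma symplecticForm_zero_left (z : PhaseSpace d) : symplecticForm 0 z = 0 := by
  simp [symplecticForm]

lemma continuous_symplecticForm :
    Continuous fun p : PhaseSpace d × PhaseSpace d => symplecticForm p.1 p.2 := by
  unfold symplecticForm
  fun_prop

lemma continuous_circle_symplecticForm :
    Continuous fun p : PhaseSpace d × PhaseSpace d => (𝐞 (-symplecticForm p.1 p.2) : ℂ) :=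
  continuous_subtype_val.comp
    (Real.continuous_fourierChar.comp continuous_symplecticForm.neg)

@[simp]
lemma reflect_apply (f : 𝓢(PhaseSpace d, ℂ)) (z : PhaseSpace d) : reflect f z = f (-z) := rfl

lemma reflect_reflect (f : 𝓢(PhaseSpace d, ℂ)) : reflect (reflect f) = f := by
  ext z; simp

lemma reflect_mulS (h f : 𝓢(PhaseSpace d, ℂ)) :
    reflect (mulS h f) = mulS (reflect h) (reflect f) := by
  ext z; simp

lemma reflect_symplecticFourier (f : 𝓢(PhaseSpace d, ℂ)) :
    reflect (symplecticFourier f) = symplecticFourier (reflect f) := by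
  ext w
  rw [reflect_apply, symplecticFourier_apply, symplecticFourier_apply,
    ← integral_neg_eq_self]
  simp [symplecticForm_neg_left, symplecticForm_neg_right]

lemma inner_symplecticRotation (w z : PhaseSpace d) :
    ⟪WithLp.toLp 2 z, symplecticRotation w⟫_ℝ = symplecticForm w z := by
  rw [WithLp.prod_inner_apply]
  simp [symplecticRotation, symplecticForm, real_inner_comm, sub_eq_add_neg]

lemma measurePreserving_symplecticRotation :
    MeasurePreserving (symplecticRotation (d := d)) := by
  have h1 : MeasurePreserving (Prod.swap : PhaseSpace d → PhaseSpace d) :=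
    Measure.measurePreserving_swap
  have h2 : MeasurePreserving (Prod.map id Neg.neg : PhaseSpace d → PhaseSpace d) :=
    (MeasurePreserving.id volume).prod (Measure.measurePreserving_neg (volume : Measure (Config d)))
  exact (WithLp.volume_preserving_toLp (Config d) (Config d)).comp (h2.comp h1)

/-- Since σ is antisymmetric, the measure-preserving rotation turns the outer transform into the
inverse Euclidean Fourier transform, so Fourier inversion applies and no reflection remains. -/
lemma symplecticFourier_symplecticFourier (f : 𝓢(PhaseSpace d, ℂ)) :
    symplecticFourier (symplecticFourier f) = f := by
  ext w
  set f' : 𝓢(WithLp 2 (PhaseSpace d), ℂ) := SchwartzMap.compCLMOfContinuousLinearEquiv ℂ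
      (WithLp.prodContinuousLinearEquiv 2 ℝ (Config d) (Config d)) f with hf'
  have h : ∀ z, symplecticFourier f z = 𝓕 f' (symplecticRotation z) := fun z => rfl
  rw [symplecticFourier_apply]
  have e : ∀ z : PhaseSpace d, 𝐞 (-symplecticForm w z) • symplecticFourier f z =
      (fun v : WithLp 2 (PhaseSpace d) => 𝐞 ⟪v, WithLp.toLp 2 w⟫_ℝ • 𝓕 f' v)
        (symplecticRotation z) := by
    intro z
    simp only [h]
    rw [real_inner_comm, inner_symplecticRotation, symplecticForm_swap, neg_neg]
  simp_rw [e]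
  rw [measurePreserving_symplecticRotation.integral_comp
    symplecticRotation.toHomeomorph.measurableEmbedding
    (fun v : WithLp 2 (PhaseSpace d) => 𝐞 ⟪v, WithLp.toLp 2 w⟫_ℝ • 𝓕 f' v), ← Real.fourierInv_eq, ← fourierInv_coe,
    fourierInv_fourier_eq]
  rfl

lemma symplecticFourierDistr_symplecticFourierDistr (u : 𝓢'(PhaseSpace d, ℂ)) :
    symplecticFourierDistr (symplecticFourierDistr u) = u := by
  ext φ
  rw [symplecticFourierDistr_apply, symplecticFourierDistr_apply, reflect_symplecticFourier,
    reflect_symplecticFourier, ← reflect_symplecticFourier (symplecticFourier _),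
    symplecticFourier_symplecticFourier, reflect_reflect]

lemma weylOp_symplecticFourierDistr (u : 𝓢'(PhaseSpace d, ℂ)) :
    weylOp (symplecticFourierDistr u) = rho u := by
  rw [weylOp, symplecticFourierDistr_symplecticFourierDistr]

/-- `⟨u, ψ⟩ = ⟨F_σ u, F_σ ψ(-·)⟩`. -/
lemma apply_eq_symplecticFourierDistr (u : 𝓢'(PhaseSpace d, ℂ)) (ψ : 𝓢(PhaseSpace d, ℂ)) :
    u ψ = symplecticFourierDistr u (symplecticFourier (reflect ψ)) := by
  rw [symplecticFourierDistr_apply, symplecticFourier_symplecticFourier, reflect_reflect]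

/-- The symplectic Fourier transform exchanges products and convolutions. -/
lemma symplecticFourier_mulS (k φ : 𝓢(PhaseSpace d, ℂ)) (z : PhaseSpace d) :
    symplecticFourier (mulS k (symplecticFourier φ)) z =
      ∫ y, φ y * symplecticFourier k (z - y) := by
  have hint : Integrable (fun p : PhaseSpace d × PhaseSpace d =>
      (𝐞 (-symplecticForm z p.1) * 𝐞 (-symplecticForm p.1 p.2) : ℂ) * (k p.1 * φ p.2))
      (volume.prod volume) := by
    refine ((k.integrable (μ := volume)).mul_prod (φ.integrable (μ := volume))).bdd_mul (c := 1) ?_ ?_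
    · refine Continuous.aestronglyMeasurable ?_
      exact (continuous_circle_symplecticForm.comp (by fun_prop :
        Continuous fun p : PhaseSpace d × PhaseSpace d => (z, p.1))).mul
          continuous_circle_symplecticForm
    · exact Filter.Eventually.of_forall fun p => by rw [norm_mul, Circle.norm_coe, Circle.norm_coe, one_mul]
  calc symplecticFourier (mulS k (symplecticFourier φ)) z
      = ∫ w, ∫ y, (𝐞 (-symplecticForm z w) * 𝐞 (-symplecticForm w y) : ℂ) * (k w * φ y) := by
        rw [symplecticFourier_apply]
        congr 1 with w
        rw [mulS_apply, symplecticFourier_apply, ← integral_const_mul, Circle.smul_def,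
          smul_eq_mul, ← integral_const_mul]
        congr 1 with y
        rw [Circle.smul_def, smul_eq_mul]
        ring
    _ = ∫ y, ∫ w, (𝐞 (-symplecticForm z w) * 𝐞 (-symplecticForm w y) : ℂ) * (k w * φ y) :=
        integral_integral_swap hint
    _ = ∫ y, φ y * symplecticFourier k (z - y) := by
        congr 1 with y
        rw [symplecticFourier_apply, ← integral_const_mul]
        congr 1 with w
        rw [Circle.smul_def, smul_eq_mul, symplecticForm_sub_left, symplecticForm_swap y w,
          neg_sub, show -symplecticForm w y - symplecticForm z w =
            -symplecticForm z w + -symplecticForm w y by ring, AddChar.map_add_eq_mul,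
          Circle.coe_mul]
        ring

end SymplecticFourier

/-! ### Functionals bounded in a weighted L² norm, and convolution. -/

section Convolution

lemma memLp_two_one_add_pow_neg {E : Type*} [NormedAddCommGroup E] [MeasurableSpace E]
    [BorelSpace E] (μ : Measure E) [μ.HasTemperateGrowth] :
    MemLp (fun x : E => (1 + ‖x‖) ^ (-(μ.integrablePower : ℝ))) 2 μ := by
  have hc : Continuous fun x : E => (1 + ‖x‖) ^ (-(μ.integrablePower : ℝ)) :=
    (continuous_const.add continuous_norm).rpow_const
      fun x => Or.inl (by positivity : (0 : ℝ) < 1 + ‖x‖).ne'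
  rw [memLp_two_iff_integrable_sq hc.aestronglyMeasurable]
  refine (Measure.integrable_pow_neg_integrablePower μ).mono' (hc.pow 2).aestronglyMeasurable
    (Filter.Eventually.of_forall fun x => ?_)
  have h1 : (1 + ‖x‖) ^ (-(μ.integrablePower : ℝ)) ≤ 1 :=
    Real.rpow_le_one_of_one_le_of_nonpos (by simp) (by simp)
  rw [Real.norm_of_nonneg (by positivity), sq]
  exact mul_le_of_le_one_left (by positivity) h1

variable {E : Type*} [NormedAddCommGroup E] [NormedSpace ℝ E]

lemma exists_one_add_pow_mul_le (f : 𝓢(E, ℂ)) (k : ℕ) :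
    ∃ C : ℝ, 0 ≤ C ∧ ∀ x, (1 + ‖x‖) ^ k * ‖f x‖ ≤ C := by
  refine ⟨2 ^ k * (Finset.Iic (k, 0)).sup (schwartzSeminormFamily ℂ E ℂ) f, by positivity,
    fun x => ?_⟩
  have h := SchwartzMap.one_add_le_sup_seminorm_apply (𝕜 := ℂ) (m := (k, 0)) le_rfl le_rfl f x
  rwa [norm_iteratedFDeriv_zero] at h

variable [FiniteDimensional ℝ E] [MeasurableSpace E] [BorelSpace E]

/-- A functional on Schwartz functions which is bounded for some weighted `L²`-norm is given by
integration. -/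
lemma exists_eq_integral_of_norm_le_toLp {μ : Measure E} [μ.HasTemperateGrowth]
    [IsFiniteMeasureOnCompacts μ] (l : 𝓢(E, ℂ) →ₗ[ℂ] ℂ) {C : ℝ}
    (hl : ∀ f, ‖l f‖ ≤ C * ‖f.toLp 2 μ‖) :
    ∃ b : Lp ℂ 2 μ, ∀ f : 𝓢(E, ℂ), l f = ∫ y, (starRingEnd ℂ) (b y) * f y ∂μ := by
  -- Density of the Schwartz functions extends the functional to all of L²(μ), where the Riesz
  -- theorem represents it.
  have hd : DenseRange (SchwartzMap.toLpCLM ℂ ℂ 2 μ : 𝓢(E, ℂ) →ₗ[ℂ] Lp ℂ 2 μ) :=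
    SchwartzMap.denseRange_toLpCLM (F := ℂ) (μ := μ) (p := 2) ENNReal.ofNat_ne_top
  refine ⟨(InnerProductSpace.toDual ℂ (Lp ℂ 2 μ)).symm
    (l.extendOfNorm (SchwartzMap.toLpCLM ℂ ℂ 2 μ : 𝓢(E, ℂ) →ₗ[ℂ] Lp ℂ 2 μ)), fun f => ?_⟩
  rw [← LinearMap.extendOfNorm_eq hd ⟨C, hl⟩ f, ← InnerProductSpace.toDual_symm_apply,
    L2.inner_def]
  refine integral_congr_ae ?_
  filter_upwards [f.coeFn_toLp 2 μ] with y hy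
  change inner ℂ _ ((f.toLp 2 μ) y) = _
  rw [hy, RCLike.inner_apply, mul_comm]

/-- A functional on Schwartz functions which is bounded for some weighted `L²`-norm commutes with
convolution integrals. -/
lemma apply_convolution_of_norm_le_toLp {μ ν : Measure E} [μ.HasTemperateGrowth]
    [IsFiniteMeasureOnCompacts μ] [SFinite μ] [ν.HasTemperateGrowth] [SFinite ν]
    (l : 𝓢(E, ℂ) →ₗ[ℂ] ℂ) {C : ℝ} (hl : ∀ f, ‖l f‖ ≤ C * ‖f.toLp 2 μ‖) (φ η Φ : 𝓢(E, ℂ))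
    (hΦ : ∀ y, Φ y = ∫ z, φ z * η (y - z) ∂ν) :
    l Φ = ∫ z, φ z * l (SchwartzMap.compSubConstCLM ℂ z η) ∂ν := by
  obtain ⟨b, hb⟩ := exists_eq_integral_of_norm_le_toLp l hl
  set K := μ.integrablePower with hK
  set L := ν.integrablePower with hL
  obtain ⟨S, hS0, hS⟩ := exists_one_add_pow_mul_le η K
  -- Of the K + L powers of decay of φ, L give integrability in z, and K pay for the weight in y
  -- that is transferred to z and y − z.
  obtain ⟨S', hS'0, hS'⟩ := exists_one_add_pow_mul_le φ (K + L)
  have hB : Integrable (fun y => ‖b y‖ * (1 + ‖y‖) ^ (-(K : ℝ))) μ :=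
    (Lp.memLp b).norm.integrable_mul (memLp_two_one_add_pow_neg μ)
  have hint : Integrable (fun p : E × E => (starRingEnd ℂ) (b p.1) * (φ p.2 * η (p.1 - p.2)))
      (μ.prod ν) := by
    refine ((hB.mul_prod (Measure.integrable_pow_neg_integrablePower ν)).mul_const
      (S * S')).mono' ?_ (Filter.Eventually.of_forall fun p => ?_)
    · refine AEStronglyMeasurable.mul ?_ (Continuous.aestronglyMeasurable ?_)
      · exact Complex.continuous_conj.comp_aestronglyMeasurable (Lp.aestronglyMeasurable b).comp_fst
      · exact (φ.continuous.comp continuous_snd).mul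
          (η.continuous.comp (continuous_fst.sub continuous_snd))
    · obtain ⟨y, z⟩ := p
      -- Peetre's inequality, which spreads the weight in y over φ(z) and η(y − z).
      have hy : (1 : ℝ) + ‖y‖ ≤ (1 + ‖z‖) * (1 + ‖y - z‖) := by
        have : ‖y‖ ≤ ‖z‖ + ‖y - z‖ := by simpa using norm_add_le z (y - z)
        nlinarith [norm_nonneg z, norm_nonneg (y - z), mul_nonneg (norm_nonneg z)
          (norm_nonneg (y - z))]
      have h1 : (1 + ‖y‖) ^ K * (1 + ‖z‖) ^ L * (‖φ z‖ * ‖η (y - z)‖) ≤ S * S' := by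
        calc (1 + ‖y‖) ^ K * (1 + ‖z‖) ^ L * (‖φ z‖ * ‖η (y - z)‖)
            ≤ ((1 + ‖z‖) * (1 + ‖y - z‖)) ^ K * (1 + ‖z‖) ^ L * (‖φ z‖ * ‖η (y - z)‖) := by
              gcongr
          _ = ((1 + ‖y - z‖) ^ K * ‖η (y - z)‖) * ((1 + ‖z‖) ^ (K + L) * ‖φ z‖) := by
              rw [mul_pow, pow_add]; ring
          _ ≤ S * S' := mul_le_mul (hS _) (hS' _) (by positivity) hS0
      simp only [norm_mul, RCLike.norm_conj]
      rw [Real.rpow_neg (by positivity), Real.rpow_neg (by positivity), Real.rpow_natCast,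
        Real.rpow_natCast]
      have h2 : ‖φ z‖ * ‖η (y - z)‖ ≤ ((1 + ‖y‖) ^ K)⁻¹ * ((1 + ‖z‖) ^ L)⁻¹ * (S * S') := by
        rw [← mul_inv, ← div_eq_inv_mul, le_div_iff₀' (by positivity)]
        exact h1
      calc ‖b y‖ * (‖φ z‖ * ‖η (y - z)‖)
          ≤ ‖b y‖ * (((1 + ‖y‖) ^ K)⁻¹ * ((1 + ‖z‖) ^ L)⁻¹ * (S * S')) := by gcongr
        _ = _ := by ring
  calc l Φ = ∫ y, ∫ z, (starRingEnd ℂ) (b y) * (φ z * η (y - z)) ∂ν ∂μ := by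
        rw [hb]
        congr 1 with y
        rw [hΦ, integral_const_mul]
    _ = ∫ z, ∫ y, (starRingEnd ℂ) (b y) * (φ z * η (y - z)) ∂μ ∂ν := integral_integral_swap hint
    _ = _ := by
        congr 1 with z
        rw [hb, ← integral_const_mul]
        congr 1 with y
        rw [SchwartzMap.compSubConstCLM_apply]
        ring

end Convolution

/-! ### Multiplication by Schwartz functions preserves C₀ transforms. -/

section C0
variable {d : ℕ}

/-- If `F_σ u` is a `C₀`-function then so is `F_σ (h u)` for a Schwartz function `h`. -/
lemma vanishesAtInfinity_mulDistr {u : 𝓢'(PhaseSpace d, ℂ)}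
    (hu : VanishesAtInfinity (symplecticFourierDistr u)) (h : 𝓢(PhaseSpace d, ℂ)) :
    VanishesAtInfinity (symplecticFourierDistr (mulDistr h u)) := by
  obtain ⟨f, hf⟩ := hu
  set κ := symplecticFourier (reflect h) with hκ
  have hfb : ∀ z, ‖f z‖ ≤ ‖f.toBCF‖ := fun z => f.toBCF.norm_coe_le_norm z
  have hmeas : ∀ y : PhaseSpace d, AEStronglyMeasurable (fun s => f (y + s) * κ s) volume :=
    fun y => ((f.continuous.comp (continuous_const.add continuous_id)).mul
      κ.continuous).aestronglyMeasurable
  have hbd : ∀ y s : PhaseSpace d, ‖f (y + s) * κ s‖ ≤ ‖f.toBCF‖ * ‖κ s‖ := fun y s => by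
    rw [norm_mul]; gcongr; exact hfb _
  have hbi : Integrable (fun s : PhaseSpace d => ‖f.toBCF‖ * ‖κ s‖) :=
    (κ.integrable (μ := volume)).norm.const_mul _
  -- Dominated convergence along a filter requires it to be countably generated.
  have hcg : (Filter.cocompact (PhaseSpace d)).IsCountablyGenerated := by
    rw [← Metric.cobounded_eq_cocompact, ← comap_norm_atTop]; infer_instance
  -- The convolution is written with the shift on f: continuity and decay then both follow by
  -- dominated convergence with the single majorant ‖f‖_∞ |κ|.
  refine ⟨⟨⟨fun y => ∫ s, f (y + s) * κ s, ?_⟩, ?_⟩, fun φ => ?_⟩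
  · refine continuous_of_dominated hmeas (fun y => Filter.Eventually.of_forall (hbd y)) hbi
      (Filter.Eventually.of_forall fun s => ?_)
    exact (f.continuous.comp (continuous_id.add continuous_const)).mul continuous_const
  · have := tendsto_integral_filter_of_dominated_convergence (μ := volume)
      (l := Filter.cocompact (PhaseSpace d)) (F := fun y s => f (y + s) * κ s) (f := fun _ => 0)
      (fun s => ‖f.toBCF‖ * ‖κ s‖) (Filter.Eventually.of_forall hmeas)
      (Filter.Eventually.of_forall fun y => Filter.Eventually.of_forall (hbd y)) hbi
      (Filter.Eventually.of_forall fun s => ?_)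
    · simpa using this
    · have h1 := f.zero_at_infty'.comp (Homeomorph.addRight s).isClosedEmbedding.tendsto_cocompact
      simpa using h1.mul_const (κ s)
  · have hint : Integrable (fun p : PhaseSpace d × PhaseSpace d =>
        f p.1 * (φ p.2 * κ (p.1 - p.2))) (volume.prod volume) := by
      refine (Integrable.convolution_integrand (ContinuousLinearMap.mul ℂ ℂ)
        (φ.integrable (μ := volume)) (κ.integrable (μ := volume))).bdd_mul (c := ‖f.toBCF‖) ?_ ?_
      · exact (f.continuous.comp continuous_fst).aestronglyMeasurable
      · exact Filter.Eventually.of_forall fun p => hfb _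
    calc symplecticFourierDistr (mulDistr h u) φ
        = ∫ z : PhaseSpace d, ∫ y, f z * (φ y * κ (z - y)) := by
          rw [symplecticFourierDistr_apply, mulDistr_apply, apply_eq_symplecticFourierDistr,
            reflect_mulS, reflect_reflect, hf]
          congr 1 with z
          rw [symplecticFourier_mulS, integral_const_mul]
      _ = ∫ y : PhaseSpace d, ∫ z, f z * (φ y * κ (z - y)) := integral_integral_swap hint
      _ = _ := by
          congr 1 with y
          change _ = (∫ s, f (y + s) * κ s) * φ y
          rw [← integral_mul_const, ← integral_add_right_eq_self _ y]
          congr 1 with z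
          rw [add_sub_cancel_right, add_comm z y]
          ring

end C0

/-! ### Polynomially weighted measures. -/

section WeightedMeasure
variable {E : Type*} [NormedAddCommGroup E] [MeasurableSpace E] [BorelSpace E]

/-- The measure `(1 + ‖x‖)^n dμ`. -/
def polyWeight (μ : Measure E) (n : ℕ) : Measure E :=
  μ.withDensity fun x => (((1 + ‖x‖₊) ^ n : NNReal) : ENNReal)

lemma integral_polyWeight (μ : Measure E) (n : ℕ) (f : E → ℝ) :
    ∫ x, f x ∂(polyWeight μ n) = ∫ x, (1 + ‖x‖) ^ n * f x ∂μ := by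
  rw [polyWeight, integral_withDensity_eq_integral_smul
    (f := fun x : E => (1 + ‖x‖₊) ^ n) (by fun_prop)]
  rfl

instance hasTemperateGrowth_polyWeight (μ : Measure E) [μ.HasTemperateGrowth] (n : ℕ) :
    (polyWeight μ n).HasTemperateGrowth := by
  refine ⟨⟨μ.integrablePower + n, ?_⟩⟩
  rw [polyWeight, integrable_withDensity_iff_integrable_smul
    (f := fun x : E => (1 + ‖x‖₊) ^ n) (by fun_prop)]
  refine (Measure.integrable_pow_neg_integrablePower μ).congr
    (Filter.Eventually.of_forall fun x => ?_)
  have h : (0 : ℝ) < 1 + ‖x‖ := by positivity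
  simp only [NNReal.smul_def, NNReal.coe_pow, NNReal.coe_add, NNReal.coe_one, coe_nnnorm,
    smul_eq_mul]
  rw [← Real.rpow_natCast, ← Real.rpow_add h]
  congr 1
  push_cast
  ring

instance isLocallyFiniteMeasure_polyWeight (μ : Measure E) [IsLocallyFiniteMeasure μ] (n : ℕ) :
    IsLocallyFiniteMeasure (polyWeight μ n) :=
  IsLocallyFiniteMeasure.withDensity_coe (by fun_prop)

instance sFinite_polyWeight (μ : Measure E) [SFinite μ] (n : ℕ) : SFinite (polyWeight μ n) := by
  unfold polyWeight
  infer_instance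

variable [NormedSpace ℝ E]

lemma integrable_one_add_pow_mul (μ : Measure E) [μ.HasTemperateGrowth] (f : 𝓢(E, ℂ)) (n : ℕ)
    [SecondCountableTopology E] :
    Integrable (fun x => (1 + ‖x‖) ^ n * ‖f x‖) μ := by
  obtain ⟨C, hC0, hC⟩ := exists_one_add_pow_mul_le f (n + μ.integrablePower)
  refine ((Measure.integrable_pow_neg_integrablePower μ).mul_const C).mono'
    (Continuous.aestronglyMeasurable (by fun_prop)) (Filter.Eventually.of_forall fun x => ?_)
  rw [Real.norm_of_nonneg (by positivity), Real.rpow_neg (by positivity), Real.rpow_natCast,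
    ← div_eq_inv_mul, le_div_iff₀ (by positivity)]
  refine le_trans (le_of_eq ?_) (hC x)
  rw [pow_add]; ring

/-- Cauchy–Schwarz after splitting off the square-integrable weight (1 + ‖x‖)^{-D}; the other
factor, squared, carries the weight 2(n + D). This trades the L¹ bounds natural for Fourier
transforms for L² bounds, to which the Riesz theorem applies. -/
lemma integral_one_add_pow_mul_le [FiniteDimensional ℝ E] (μ : Measure E) [μ.HasTemperateGrowth]
    (n : ℕ) :
    ∃ C : ℝ, 0 ≤ C ∧ ∀ f : 𝓢(E, ℂ), ∫ x, (1 + ‖x‖) ^ n * ‖f x‖ ∂μ ≤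
      C * ‖f.toLp 2 (polyWeight μ (2 * (n + μ.integrablePower)))‖ := by
  set D := μ.integrablePower with hD
  refine ⟨(∫ x : E, ((1 + ‖x‖) ^ (-(D : ℝ))) ^ (2 : ℝ) ∂μ) ^ (1 / 2 : ℝ), by positivity,
    fun f => ?_⟩
  have h2 : ENNReal.ofReal 2 = 2 := by simp
  have hb : MemLp (fun x => (1 + ‖x‖) ^ (n + D) * ‖f x‖) 2 μ := by
    have hc : Continuous fun x => (1 + ‖x‖) ^ (n + D) * ‖f x‖ := by fun_prop
    rw [memLp_two_iff_integrable_sq hc.aestronglyMeasurable]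
    obtain ⟨C, hC0, hC⟩ := exists_one_add_pow_mul_le f (n + D)
    refine ((integrable_one_add_pow_mul μ f (n + D)).const_mul C).mono'
      (hc.pow 2).aestronglyMeasurable (Filter.Eventually.of_forall fun x => ?_)
    rw [Real.norm_of_nonneg (by positivity), sq]
    gcongr
    exact hC x
  have key := integral_mul_le_Lp_mul_Lq_of_nonneg (μ := μ) Real.HolderConjugate.two_two
    (f := fun x : E => (1 + ‖x‖) ^ (-(D : ℝ))) (g := fun x => (1 + ‖x‖) ^ (n + D) * ‖f x‖)
    (Filter.Eventually.of_forall fun x => by positivity)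
    (Filter.Eventually.of_forall fun x => by positivity)
    (by rw [h2]; exact memLp_two_one_add_pow_neg μ) (by rw [h2]; exact hb)
  have e1 : ∀ x : E, (1 + ‖x‖) ^ (-(D : ℝ)) * ((1 + ‖x‖) ^ (n + D) * ‖f x‖) =
      (1 + ‖x‖) ^ n * ‖f x‖ := fun x => by
    rw [Real.rpow_neg (by positivity), Real.rpow_natCast, pow_add]
    field_simp
  have e2 : ∫ x : E, ((1 + ‖x‖) ^ (n + D) * ‖f x‖) ^ (2 : ℝ) ∂μ =
      ‖f.toLp 2 (polyWeight μ (2 * (n + D)))‖ ^ 2 := by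
    rw [norm_toLp_two_sq, integral_polyWeight]
    congr 1 with x
    rw [Real.rpow_two]
    ring
  rw [e2, ← Real.sqrt_eq_rpow (‖f.toLp 2 (polyWeight μ (2 * (n + D)))‖ ^ 2),
    Real.sqrt_sq (norm_nonneg _)] at key
  simp_rw [e1] at key
  exact key

end WeightedMeasure

/-! ### The transform of a compactly supported distribution as a function. -/

section Exchange
variable {d : ℕ}

/-- Each derivative of a Fourier integral brings down one factor of the integration variable. The
map `A` accounts for reflection and rotation, and `B` for the passage from the product norm to the
Euclidean one. -/
lemma norm_iteratedFDeriv_reflect_symplecticFourier_le (n : ℕ) :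
    ∃ C : ℝ, 0 ≤ C ∧ ∀ (f : 𝓢(PhaseSpace d, ℂ)) (z : PhaseSpace d),
      ‖iteratedFDeriv ℝ n (reflect (symplecticFourier f)) z‖ ≤
        C * ∫ x, (1 + ‖x‖) ^ n * ‖f x‖ := by
  set A : PhaseSpace d →L[ℝ] WithLp 2 (PhaseSpace d) :=
    ((ContinuousLinearEquiv.neg ℝ (M := PhaseSpace d)).trans
      symplecticRotation).toContinuousLinearMap
  set B : PhaseSpace d →L[ℝ] WithLp 2 (PhaseSpace d) :=
    ((WithLp.prodContinuousLinearEquiv 2 ℝ (Config d) (Config d)).symm :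
      PhaseSpace d →L[ℝ] WithLp 2 (PhaseSpace d))
  refine ⟨(2 * π) ^ n * ((n + 1) * (1 + ‖B‖) ^ n) * ‖A‖ ^ n,
    by positivity, fun f z => ?_⟩
  set f' : 𝓢(WithLp 2 (PhaseSpace d), ℂ) := SchwartzMap.compCLMOfContinuousLinearEquiv ℂ
      (WithLp.prodContinuousLinearEquiv 2 ℝ (Config d) (Config d)) f with hf'
  have e : (reflect (symplecticFourier f) : PhaseSpace d → ℂ) =
      (𝓕 f' : 𝓢(WithLp 2 (PhaseSpace d), ℂ)) ∘ A := rfl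
  rw [e, ContinuousLinearMap.iteratedFDeriv_comp_right _ ((𝓕 f').smooth ⊤) z (i := n)
    (mod_cast le_top)]
  refine (ContinuousMultilinearMap.norm_compContinuousLinearMap_le _ _).trans ?_
  rw [Finset.prod_const, Finset.card_univ, Fintype.card_fin, mul_right_comm]
  gcongr
  have h1 := Real.pow_mul_norm_iteratedFDeriv_fourier_le (f := f') (K := ⊤) (N := ⊤)
    (f'.smooth ⊤) (fun k n _ _ => f'.integrable_pow_mul_iteratedFDeriv volume k n)
    (k := n) (n := 0) le_top le_top (A z)
  simp only [pow_zero, one_mul, mul_one, zero_add, Finset.range_one, Finset.product_singleton,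
    Finset.sum_map, Function.Embedding.coeFn_mk, norm_iteratedFDeriv_zero] at h1
  rw [SchwartzMap.fourier_coe]
  refine h1.trans ?_
  rw [mul_assoc]
  gcongr
  refine (Finset.sum_le_card_nsmul _ _ ((1 + ‖B‖) ^ n * ∫ x, (1 + ‖x‖) ^ n * ‖f x‖)
    fun p hp => ?_).trans_eq (by simp [mul_assoc])
  have hpn : p ≤ n := Nat.lt_succ_iff.1 (Finset.mem_range.1 hp)
  have e2 : ∫ v, ‖v‖ ^ p * ‖f' v‖ = ∫ x : PhaseSpace d, ‖B x‖ ^ p * ‖f x‖ :=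
    ((WithLp.volume_preserving_toLp (Config d) (Config d)).integral_comp
      (MeasurableEquiv.toLp 2 (PhaseSpace d)).measurableEmbedding
        (fun v => ‖v‖ ^ p * ‖f' v‖)).symm
  rw [e2, ← integral_const_mul]
  refine integral_mono_of_nonneg (Filter.Eventually.of_forall fun x => by positivity)
    ((integrable_one_add_pow_mul volume f n).const_mul _) (Filter.Eventually.of_forall fun x => ?_)
  simp only
  rw [← mul_assoc, ← mul_pow]
  gcongr
  have h3 : ‖B x‖ ≤ (1 + ‖B‖) * (1 + ‖x‖) := by
    refine (B.le_opNorm x).trans ?_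
    nlinarith [norm_nonneg B, norm_nonneg x]
  have h4 : 1 ≤ (1 + ‖B‖) * (1 + ‖x‖) :=
    one_le_mul_of_one_le_of_one_le (by simp) (by simp)
  exact (pow_le_pow_left₀ (norm_nonneg _) h3 p).trans (pow_le_pow_right₀ h4 hpn)

/-- The Leibniz rule with all the decay placed on χ, so that ψ only needs bounded derivatives. -/
lemma seminorm_mulS_le {E : Type*} [NormedAddCommGroup E] [NormedSpace ℝ E] (χ ψ : 𝓢(E, ℂ))
    (k n : ℕ) {B : ℝ} (hB0 : 0 ≤ B)
    (hB : ∀ j ≤ n, ∀ z, ‖iteratedFDeriv ℝ j ψ z‖ ≤ B) :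
    SchwartzMap.seminorm ℂ k n (mulS χ ψ) ≤
      (∑ i ∈ Finset.range (n + 1), (n.choose i : ℝ) * SchwartzMap.seminorm ℂ k i χ) * B := by
  refine SchwartzMap.seminorm_le_bound ℂ k n _ (by positivity) fun z => ?_
  have e : (mulS χ ψ : E → ℂ) = fun z => χ z * ψ z := funext fun z => mulS_apply χ ψ z
  rw [e]
  refine (mul_le_mul_of_nonneg_left (norm_iteratedFDeriv_mul_le (𝕜 := ℝ) (n := n) (N := ∞)
    (χ.smooth ⊤) (ψ.smooth ⊤) z (mod_cast le_top)) (by positivity)).trans ?_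
  rw [Finset.mul_sum, Finset.sum_mul]
  refine Finset.sum_le_sum fun i _ => ?_
  calc ‖z‖ ^ k * ((n.choose i : ℝ) * ‖iteratedFDeriv ℝ i χ z‖ * ‖iteratedFDeriv ℝ (n - i) ψ z‖)
      = (n.choose i : ℝ) * (‖z‖ ^ k * ‖iteratedFDeriv ℝ i χ z‖) *
          ‖iteratedFDeriv ℝ (n - i) ψ z‖ := by ring
    _ ≤ _ := by
      gcongr
      · exact SchwartzMap.le_seminorm ℂ k i χ z
      · exact hB _ (Nat.sub_le _ _) z

/-- If `χ` is a Schwartz function then `F_σ (χ u)` is bounded by a weighted `L²`-norm. -/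
lemma norm_symplecticFourierDistr_mulDistr_le (u : 𝓢'(PhaseSpace d, ℂ))
    (χ : 𝓢(PhaseSpace d, ℂ)) :
    ∃ (N : ℕ) (C : ℝ), ∀ f, ‖symplecticFourierDistr (mulDistr χ u) f‖ ≤
      C * ‖f.toLp 2 (polyWeight (volume : Measure (PhaseSpace d)) N)‖ := by
  obtain ⟨s, C, -, hC⟩ := Seminorm.bound_of_continuous (schwartz_withSeminorms ℂ (PhaseSpace d) ℂ)
    ((normSeminorm ℂ ℂ).comp (u : 𝓢(PhaseSpace d, ℂ) →L[ℂ] ℂ).toLinearMap)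
    (continuous_norm.comp u.continuous)
  choose c hc0 hc using norm_iteratedFDeriv_reflect_symplecticFourier_le (d := d)
  -- The highest order of differentiation in the seminorms that control u.
  set N := s.sup Prod.snd with hN
  obtain ⟨C', hC'0, hC'⟩ := integral_one_add_pow_mul_le (volume : Measure (PhaseSpace d)) N
  set a : ℕ × ℕ → ℝ := fun i => ∑ j ∈ Finset.range (i.2 + 1),
    (i.2.choose j : ℝ) * SchwartzMap.seminorm ℂ i.1 j χ
  set b : ℝ := ∑ j ∈ Finset.range (N + 1), c j
  have hb0 : 0 ≤ b := Finset.sum_nonneg fun j _ => hc0 j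
  have ha0 : ∀ i, 0 ≤ a i := fun i => by positivity
  refine ⟨2 * (N + (volume : Measure (PhaseSpace d)).integrablePower),
    C * ((∑ i ∈ s, a i) * (b * C')), fun f => ?_⟩
  set I := ∫ x, (1 + ‖x‖) ^ N * ‖f x‖ with hI
  have hI0 : 0 ≤ I := integral_nonneg fun x => by positivity
  have h1 : ∀ j ≤ N, ∀ z, ‖iteratedFDeriv ℝ j (reflect (symplecticFourier f)) z‖ ≤ b * I := by
    intro j hj z
    refine (hc j f z).trans ?_
    have hcb : c j ≤ b := Finset.single_le_sum (f := c) (fun j _ => hc0 j)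
      (Finset.mem_range.2 (Nat.lt_succ_iff.2 hj))
    refine mul_le_mul hcb ?_ (integral_nonneg fun x => by positivity) hb0
    refine integral_mono_of_nonneg (Filter.Eventually.of_forall fun x => by positivity)
      (integrable_one_add_pow_mul volume f N) (Filter.Eventually.of_forall fun x => ?_)
    simp only
    gcongr
    simp
  have h2 : s.sup (schwartzSeminormFamily ℂ (PhaseSpace d) ℂ)
      (mulS χ (reflect (symplecticFourier f))) ≤ (∑ i ∈ s, a i) * (b * I) := by
    refine Seminorm.finset_sup_apply_le
      (mul_nonneg (Finset.sum_nonneg fun i _ => ha0 i) (by positivity)) fun i hi => ?_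
    refine (seminorm_mulS_le χ _ i.1 i.2 (by positivity) fun j hj z =>
      h1 j (hj.trans (Finset.le_sup (f := Prod.snd) hi)) z).trans ?_
    gcongr
    exact Finset.single_le_sum (f := a) (fun i _ => ha0 i) hi
  calc ‖symplecticFourierDistr (mulDistr χ u) f‖
      ≤ C * s.sup (schwartzSeminormFamily ℂ (PhaseSpace d) ℂ)
        (mulS χ (reflect (symplecticFourier f))) := hC _
    _ ≤ C * ((∑ i ∈ s, a i) * (b * I)) := by gcongr
    _ ≤ C * ((∑ i ∈ s, a i) * (b * (C' * ‖f.toLp 2 (polyWeight (volume : Measure (PhaseSpace d))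
          (2 * (N + (volume : Measure (PhaseSpace d)).integrablePower)))‖))) := by
        have := Finset.sum_nonneg fun i (_ : i ∈ s) => ha0 i
        gcongr
        exact hC' f
    _ = _ := by ring

/-- The function `z ↦ ⟨u, G e^{-2πi σ(z, ·)}⟩` represents `F_σ (G u)`. -/
lemma symplecticFourierDistr_mulDistr_eq_integral {u : 𝓢'(PhaseSpace d, ℂ)}
    {χ : 𝓢(PhaseSpace d, ℂ)} (hχ : mulDistr χ u = u) (G : 𝓢(PhaseSpace d, ℂ))
    (e : PhaseSpace d → 𝓢(PhaseSpace d, ℂ))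
    (he : ∀ z w, e z w = 𝐞 (-symplecticForm z w) * G w) (φ : 𝓢(PhaseSpace d, ℂ)) :
    symplecticFourierDistr (mulDistr G u) φ = ∫ z, u (e z) * φ z := by
  obtain ⟨N, C, hC⟩ := norm_symplecticFourierDistr_mulDistr_le u χ
  rw [hχ] at hC
  set η := symplecticFourier (reflect G) with hη
  -- The transform of a product is a convolution, and F_σ u may be moved under its integral because
  -- `χ u = u` makes it bounded in a weighted L² norm.
  have h1 := apply_convolution_of_norm_le_toLp (ν := volume)
    ((symplecticFourierDistr u : 𝓢(PhaseSpace d, ℂ) →L[ℂ] ℂ) : 𝓢(PhaseSpace d, ℂ) →ₗ[ℂ] ℂ) hC φ η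
    (symplecticFourier (mulS (reflect G) (symplecticFourier φ)))
    (fun y => symplecticFourier_mulS _ _ y)
  have h2 : symplecticFourierDistr (mulDistr G u) φ = symplecticFourierDistr u
      (symplecticFourier (mulS (reflect G) (symplecticFourier φ))) := by
    rw [symplecticFourierDistr_apply, mulDistr_apply, apply_eq_symplecticFourierDistr,
      reflect_mulS, reflect_reflect]
  rw [h2]
  refine h1.trans ?_
  congr 1 with z
  rw [mul_comm]
  congr 1
  -- It remains to see that transforming and reflecting the translate η(· − z) gives the modulated
  -- function e z.
  change symplecticFourierDistr u _ = _
  rw [symplecticFourierDistr_apply]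
  congr 1
  ext w
  rw [reflect_apply, symplecticFourier_apply, he,
    ← integral_add_right_eq_self _ z]
  have h3 : symplecticFourier η (-w) = G w := by
    rw [hη, symplecticFourier_symplecticFourier, reflect_apply, neg_neg]
  rw [← h3, symplecticFourier_apply, ← integral_const_mul]
  congr 1 with y
  rw [SchwartzMap.compSubConstCLM_apply, add_sub_cancel_right, Circle.smul_def, Circle.smul_def,
    smul_eq_mul, smul_eq_mul, ← mul_assoc, ← Circle.coe_mul, ← AddChar.map_add_eq_mul]
  congr 3
  rw [symplecticForm_swap (-w) (y + z), symplecticForm_swap (-w) y, symplecticForm_neg_right,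
    symplecticForm_neg_right, ← sub_neg_eq_add y z, symplecticForm_sub_left,
    symplecticForm_neg_left]
  ring

end Exchange

/-! ### Distributions vanish off their support; cutoffs. -/

section Support
variable {E : Type*} [NormedAddCommGroup E] [NormedSpace ℝ E]

open scoped Manifold in
/-- A tempered distribution vanishes on compactly supported test functions supported in the
complement of its support. -/
lemma apply_eq_zero_of_hasCompactSupport [FiniteDimensional ℝ E] (u : 𝓢'(E, ℂ)) (φ : 𝓢(E, ℂ))
    (hc : HasCompactSupport φ) (hφ : tsupport φ ⊆ (Distribution.dsupport u)ᶜ) : u φ = 0 := by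
  choose! V hV hVo hxV using fun x (hx : x ∈ tsupport φ) =>
    (Distribution.notMem_dsupport_iff x).1 (hφ hx)
  obtain ⟨t, ht, htc⟩ := hc.isCompact.elim_nhds_subcover V
    fun x hx => (hVo x hx).mem_nhds (hxV x hx)
  -- A partition of unity cuts φ into finitely many pieces, each supported in an open set on which u
  -- is known to vanish.
  obtain ⟨f, hf⟩ := SmoothPartitionOfUnity.exists_isSubordinate 𝓘(ℝ, E) (isClosed_tsupport φ)
    (fun i : t => V i) (fun i => hVo i (ht i i.2)) (fun x hx => by
      obtain ⟨i, hi, hxi⟩ := Set.mem_iUnion₂.1 (htc hx)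
      exact Set.mem_iUnion.2 ⟨⟨i, hi⟩, hxi⟩)
  have hcs : ∀ i, HasCompactSupport fun x => (f i x : ℂ) * φ x := fun i => hc.mul_left
  have hsm : ∀ i, ContDiff ℝ ∞ fun x => (f i x : ℂ) * φ x := fun i =>
    (Complex.ofRealCLM.contDiff.comp (f i).contMDiff.contDiff).mul (φ.smooth ⊤)
  have hsum : φ = ∑ i, (hcs i).toSchwartzMap (hsm i) := by
    ext x
    rw [sum_apply]
    change φ x = ∑ i, (f i x : ℂ) * φ x
    rw [← Finset.sum_mul]
    by_cases hx : x ∈ tsupport φ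
    · have h1 := f.sum_eq_one hx
      rw [finsum_eq_sum_of_fintype] at h1
      rw [← Complex.ofReal_sum, h1, Complex.ofReal_one, one_mul]
    · rw [image_eq_zero_of_notMem_tsupport hx, mul_zero]
  rw [hsum, map_sum]
  refine Finset.sum_eq_zero fun i _ => hV i (ht i i.2) _ ?_
  refine subset_trans ?_ (hf i)
  refine (tsupport_mul_subset_left (f := fun x => (f i x : ℂ))).trans ?_
  refine closure_mono fun x hx => ?_
  simpa using hx

/-- The rescaling by `(n + 1)⁻¹`. -/
def shrink (n : ℕ) : E ≃L[ℝ] E :=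
  ContinuousLinearEquiv.smulLeft (Units.mk0 ((n : ℝ) + 1)⁻¹ (by positivity))

/-- Truncations of a Schwartz function converge to it. -/
lemma tendsto_mulS_shrink (χ : 𝓢(E, ℂ)) (hχ : ∀ x ∈ Metric.closedBall (0 : E) 1, χ x = 1)
    (θ : 𝓢(E, ℂ)) :
    Filter.Tendsto (fun n => mulS (SchwartzMap.compCLMOfContinuousLinearEquiv ℂ (shrink n) χ) θ)
      Filter.atTop (nhds θ) := by
  rw [(schwartz_withSeminorms ℂ E ℂ).tendsto_nhds]
  rintro ⟨k, m⟩ ε hε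
  obtain ⟨B, hB0, hB⟩ : ∃ B : ℝ, 0 ≤ B ∧ ∀ j ≤ m, ∀ x, ‖iteratedFDeriv ℝ j χ x‖ ≤ B := by
    refine ⟨∑ j ∈ Finset.range (m + 1), SchwartzMap.seminorm ℂ 0 j χ, by positivity,
      fun j hj x => (SchwartzMap.norm_iteratedFDeriv_le_seminorm ℂ χ j x).trans ?_⟩
    exact Finset.single_le_sum (f := fun j => SchwartzMap.seminorm ℂ 0 j χ)
      (fun j _ => apply_nonneg _ _) (Finset.mem_range.2 (Nat.lt_succ_iff.2 hj))
  set χ' : ℕ → 𝓢(E, ℂ) := fun n => SchwartzMap.compCLMOfContinuousLinearEquiv ℂ (shrink n) χ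
  have hχ' : ∀ n, ∀ j ≤ m, ∀ x, ‖iteratedFDeriv ℝ j (χ' n) x‖ ≤ B := by
    intro n j hj x
    have e : (χ' n : E → ℂ) = χ ∘ (shrink n : E ≃L[ℝ] E).toContinuousLinearMap := rfl
    rw [e, ContinuousLinearMap.iteratedFDeriv_comp_right _ (χ.smooth ⊤) x (i := j)
      (mod_cast le_top)]
    refine (ContinuousMultilinearMap.norm_compContinuousLinearMap_le _ _).trans ?_
    rw [Finset.prod_const]
    refine (mul_le_of_le_one_right (norm_nonneg _) (pow_le_one₀ (norm_nonneg _) ?_)).trans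
      (hB j hj _)
    refine ContinuousLinearMap.opNorm_le_bound _ zero_le_one fun y => ?_
    change ‖((n : ℝ) + 1)⁻¹ • y‖ ≤ _
    rw [norm_smul, Real.norm_of_nonneg (by positivity)]
    gcongr
    exact inv_le_one_of_one_le₀ (by simp)
  set M := (∑ i ∈ Finset.range (m + 1), (m.choose i : ℝ) * SchwartzMap.seminorm ℂ (k + 1) i θ) * B
    + SchwartzMap.seminorm ℂ (k + 1) m θ with hM
  have hM0 : 0 ≤ M := by positivity
  have key : ∀ n : ℕ, SchwartzMap.seminorm ℂ k m (mulS (χ' n) θ - θ) ≤ M / (n + 1) := by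
    intro n
    refine SchwartzMap.seminorm_le_bound ℂ k m _ (by positivity) fun x => ?_
    -- Inside the ball of radius n + 1 the cutoff is 1 and the difference vanishes. Outside it, one
    -- extra power of ‖x‖ in the seminorm gains the factor 1/(n + 1).
    by_cases hx : ‖x‖ < n + 1
    · have h0 : (mulS (χ' n) θ - θ : E → ℂ) =ᶠ[nhds x] fun _ => 0 := by
        filter_upwards [(isOpen_lt continuous_norm continuous_const).mem_nhds hx] with y hy
        have h1 : χ' n y = 1 := by
          refine hχ _ ?_
          rw [mem_closedBall_zero_iff]
          change ‖((n : ℝ) + 1)⁻¹ • y‖ ≤ 1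
          rw [norm_smul,
            Real.norm_of_nonneg (by positivity), inv_mul_le_one₀ (by positivity)]
          exact hy.le
        simp [h1]
      have e : ((mulS (χ' n) θ - θ : 𝓢(E, ℂ)) : E → ℂ) = (mulS (χ' n) θ - θ : E → ℂ) := by
        ext; rfl
      rw [e, (h0.iteratedFDeriv ℝ m).self_of_nhds, iteratedFDeriv_fun_zero]
      simp only [Pi.zero_apply, norm_zero, mul_zero]
      positivity
    · push Not at hx
      have h1 : ‖x‖ ^ (k + 1) * ‖iteratedFDeriv ℝ m (mulS (χ' n) θ - θ : 𝓢(E, ℂ)) x‖ ≤ M := by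
        refine (SchwartzMap.le_seminorm ℂ (k + 1) m _ x).trans ?_
        refine (map_sub_le_add _ _ _).trans ?_
        rw [hM]
        gcongr
        rw [mulS_comm]
        exact seminorm_mulS_le θ (χ' n) (k + 1) m hB0 (hχ' n)
      rw [le_div_iff₀ (by positivity)]
      refine le_trans ?_ h1
      rw [pow_succ, mul_right_comm]
      gcongr
  obtain ⟨N, hN⟩ := exists_nat_gt (M / ε)
  filter_upwards [Filter.eventually_ge_atTop N] with n hn
  refine (key n).trans_lt ?_
  rw [div_lt_iff₀ (by positivity)]
  rw [div_lt_iff₀ hε] at hN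
  have : (N : ℝ) ≤ n := by exact_mod_cast hn
  nlinarith

/-- A tempered distribution vanishes on test functions supported in the complement of its
support. -/
lemma apply_eq_zero_of_tsupport_subset [FiniteDimensional ℝ E] (u : 𝓢'(E, ℂ)) (φ : 𝓢(E, ℂ))
    (hφ : tsupport φ ⊆ (Distribution.dsupport u)ᶜ) : u φ = 0 := by
  let b : ContDiffBump (0 : E) := ⟨1, 2, one_pos, one_lt_two⟩
  have hbc : HasCompactSupport fun x => (b x : ℂ) :=
    b.hasCompactSupport.comp_left (g := fun r : ℝ => (r : ℂ)) Complex.ofReal_zero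
  let χ : 𝓢(E, ℂ) := hbc.toSchwartzMap (Complex.ofRealCLM.contDiff.comp b.contDiff)
  have hχ : ∀ x ∈ Metric.closedBall (0 : E) 1, χ x = 1 := fun x hx => by
    change (b x : ℂ) = 1
    rw [b.one_of_mem_closedBall hx, Complex.ofReal_one]
  have h1 := (u.continuous.tendsto φ).comp (tendsto_mulS_shrink χ hχ φ)
  refine tendsto_nhds_unique h1 (tendsto_const_nhds.congr fun n => ?_)
  have e : (mulS (SchwartzMap.compCLMOfContinuousLinearEquiv ℂ (shrink n) χ) φ : E → ℂ) =
      fun x => χ (shrink n x) * φ x := funext fun x => mulS_apply _ _ x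
  refine (apply_eq_zero_of_hasCompactSupport u _ ?_ ?_).symm
  · rw [e]
    exact (hbc.comp_homeomorph (shrink n : E ≃L[ℝ] E).toHomeomorph).mul_right
  · rw [e]
    exact tsupport_mul_subset_right.trans hφ

/-- A distribution with compact support is fixed by the multiplication with some smooth function of
compact support. -/
lemma exists_mulDistr_eq_self [FiniteDimensional ℝ E] (u : 𝓢'(E, ℂ))
    (hu : IsCompact (Distribution.dsupport u)) :
    ∃ χ : 𝓢(E, ℂ), HasCompactSupport χ ∧ mulDistr χ u = u := by
  obtain ⟨R, hR⟩ := hu.isBounded.subset_closedBall (0 : E)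
  -- The cutoff equals 1 on a ball exceeding the support of u by a margin, so χφ − φ vanishes in a
  -- neighbourhood of each point of that support. The maximum covers a negative R.
  let b : ContDiffBump (0 : E) := ⟨max R 0 + 1, max R 0 + 2, by positivity, by linarith⟩
  have hbc : HasCompactSupport fun x => (b x : ℂ) :=
    b.hasCompactSupport.comp_left (g := fun r : ℝ => (r : ℂ)) Complex.ofReal_zero
  let χ : 𝓢(E, ℂ) := hbc.toSchwartzMap (Complex.ofRealCLM.contDiff.comp b.contDiff)
  refine ⟨χ, hbc, ?_⟩
  ext φ
  rw [mulDistr_apply, ← sub_eq_zero, ← map_sub]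
  refine apply_eq_zero_of_tsupport_subset u _ ?_
  intro x hx hxu
  have hxR : ‖x‖ < max R 0 + 1 := by
    have := hR hxu
    rw [mem_closedBall_zero_iff] at this
    exact lt_of_le_of_lt (this.trans (le_max_left R 0)) (by linarith)
  refine notMem_tsupport_iff_eventuallyEq.2 ?_ hx
  filter_upwards [(isOpen_lt continuous_norm continuous_const).mem_nhds hxR] with y hy
  have h1 : χ y = 1 := by
    change (b y : ℂ) = 1
    rw [b.one_of_mem_closedBall (mem_closedBall_zero_iff.2 (le_of_lt hy)), Complex.ofReal_one]
  simp [h1]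

end Support

/-! ### The cross-ambiguity function and the Moyal identity. -/

section CrossAmbiguity
variable {d : ℕ}

/-- The transpose of `u ↦ k_u`; on `φ ⊗ ψ` it gives the cross-ambiguity function of `φ` and `ψ`. -/
def crossAmbiguity : 𝓢(PhaseSpace d, ℂ) →L[ℂ] 𝓢(PhaseSpace d, ℂ) :=
  partialFourier ∘L SchwartzMap.compCLMOfContinuousLinearEquiv ℂ (kernelCoord (d := d)).symm

lemma rho_apply (u : 𝓢'(PhaseSpace d, ℂ)) (φ ψ : 𝓢(Config d, ℂ)) :
    rho u ψ φ = u (crossAmbiguity (tensor φ ψ)) := by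
  rw [rho, kernelOp_apply]
  rfl

lemma crossAmbiguity_tensor_apply (φ ψ : 𝓢(Config d, ℂ)) (w : PhaseSpace d) :
    crossAmbiguity (tensor φ ψ) w = ∫ q, (𝐞 (-⟪q, w.2⟫_ℝ) : ℂ) *
      (φ ((1 / 2 : ℝ) • w.1 - q) * ψ (-((1 / 2 : ℝ) • w.1) - q)) := rfl

/-- The map factors as (t, x) ↦ (x, t − x) ↦ (t − x, x) = (s, x) ↦ (s, −s/2 − x). Swaps preserve the
measure, and so do the fibrewise translations and point reflections. -/
lemma measurePreserving_kernelCoord : MeasurePreserving (kernelCoord (d := d)) := by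
  have h1 : MeasurePreserving (fun z : PhaseSpace d => (z.2, z.1 - z.2)) := by
    refine MeasurePreserving.comp
      (g := fun z : PhaseSpace d => (z.1, z.2 - z.1)) (f := Prod.swap) ?_
      Measure.measurePreserving_swap
    exact (MeasurePreserving.id volume).skew_product (g := fun x t : Config d => t - x)
      (by fun_prop) (Filter.Eventually.of_forall fun x =>
        (measurePreserving_sub_right volume x).map_eq)
  have h2 : MeasurePreserving
      (fun z : PhaseSpace d => (z.1, (-((1 / 2 : ℝ) • z.1)) - z.2)) :=
    (MeasurePreserving.id volume).skew_product
      (g := fun s x : Config d => (-((1 / 2 : ℝ) • s)) - x) (by fun_prop)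
      (Filter.Eventually.of_forall fun s =>
        (Measure.measurePreserving_sub_left volume (-((1 / 2 : ℝ) • s))).map_eq)
  have h3 := h2.comp ((Measure.measurePreserving_swap (μ := (volume : Measure (Config d)))
    (ν := (volume : Measure (Config d)))).comp h1)
  convert h3 using 1
  ext z i
  · rfl
  · change (-((1 / 2 : ℝ) • (z.1 + z.2))) i = ((-((1 / 2 : ℝ) • (z.1 - z.2))) - z.2) i
    simp only [PiLp.neg_apply, PiLp.smul_apply, PiLp.add_apply, PiLp.sub_apply, smul_eq_mul]
    ring

lemma integrable_inner_schwartz {E : Type*} [NormedAddCommGroup E] [NormedSpace ℝ E]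
    [MeasurableSpace E] [BorelSpace E] [SecondCountableTopology E] (μ : Measure E)
    [μ.HasTemperateGrowth] (f g : 𝓢(E, ℂ)) :
    Integrable (fun x => inner ℂ (f x) (g x)) μ := by
  refine ((mulS g (conj f)).integrable (μ := μ)).congr (Filter.Eventually.of_forall fun x => ?_)
  simp [RCLike.inner_apply]

/-- Fubini, with Plancherel on each slice of fixed first variable. -/
lemma integral_inner_partialFourier (f g : 𝓢(PhaseSpace d, ℂ)) :
    ∫ w, inner ℂ (partialFourier f w) (partialFourier g w) = ∫ z, inner ℂ (f z) (g z) := by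
  have hf := integrable_inner_schwartz volume (partialFourier f) (partialFourier g)
  have hg := integrable_inner_schwartz volume f g
  rw [Measure.volume_eq_prod] at hf hg ⊢
  rw [integral_prod _ hf, integral_prod _ hg]
  congr 1 with x
  have h : ∀ (f : 𝓢(PhaseSpace d, ℂ)) (η : Config d),
      partialFourier f (x, η) = (𝓕 (schwartzSlice x f) : 𝓢(Config d, ℂ)) η := fun f η => by
    rw [SchwartzMap.fourier_coe]
    exact partialFourierFun_eq f (x, η)
  simp_rw [h]
  exact SchwartzMap.integral_inner_fourier_fourier _ _

/-- The Moyal identity. -/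
lemma integral_inner_crossAmbiguity (f g : 𝓢(PhaseSpace d, ℂ)) :
    ∫ w, inner ℂ (crossAmbiguity f w) (crossAmbiguity g w) = ∫ z, inner ℂ (f z) (g z) := by
  refine (integral_inner_partialFourier _ _).trans ?_
  rw [← measurePreserving_kernelCoord.integral_comp
    kernelCoord.toHomeomorph.measurableEmbedding]
  simp

end CrossAmbiguity

/-! ### Coherent states and the resolution of the identity. -/

section CoherentStates
variable {d : ℕ}

lemma iteratedDeriv_fourierChar (n : ℕ) :
    iteratedDeriv n (fun r : ℝ => (𝐞 r : ℂ)) =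
      fun r => (2 * π * Complex.I) ^ n * (𝐞 r : ℂ) := by
  induction n with
  | zero => simp
  | succ n ih =>
    rw [iteratedDeriv_succ, ih]
    funext r
    rw [deriv_const_mul _ (Real.hasDerivAt_fourierChar r).differentiableAt,
      (Real.hasDerivAt_fourierChar r).deriv]
    ring

lemma hasTemperateGrowth_fourierChar : Function.HasTemperateGrowth fun r : ℝ => (𝐞 r : ℂ) := by
  refine ⟨?_, fun n => ⟨0, ‖(2 * π * Complex.I) ^ n‖, fun r => ?_⟩⟩
  · simp only [Real.fourierChar_apply]
    exact ((Complex.ofRealCLM.contDiff.comp (contDiff_const.mul contDiff_id)).mul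
      contDiff_const).cexp
  · rw [norm_iteratedFDeriv_eq_norm_iteratedDeriv, iteratedDeriv_fourierChar, norm_mul,
      Circle.norm_coe, pow_zero]

/-- The modulation `t ↦ e^{2πi t ξ}`. -/
lemma hasTemperateGrowth_modulation (ξ : Config d) :
    Function.HasTemperateGrowth fun t : Config d => (𝐞 ⟪t, ξ⟫_ℝ : ℂ) :=
  hasTemperateGrowth_fourierChar.comp (Function.hasTemperateGrowth_inner_left ξ)

/-- The coherent state `t ↦ e^{2πi t ξ} e^{-π |t - x|²}` at the point `z = (x, ξ)`. -/
def coherent (z : PhaseSpace d) : 𝓢(Config d, ℂ) :=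
  SchwartzMap.smulLeftCLM ℂ (fun t : Config d => (𝐞 ⟪t, z.2⟫_ℝ : ℂ))
    (SchwartzMap.compSubConstCLM ℂ z.1 (gaussian (Config d)))

lemma coherent_apply (z : PhaseSpace d) (t : Config d) :
    coherent z t = 𝐞 ⟪t, z.2⟫_ℝ * gaussian (Config d) (t - z.1) := by
  rw [coherent, SchwartzMap.smulLeftCLM_apply_apply (hasTemperateGrowth_modulation z.2),
    SchwartzMap.compSubConstCLM_apply, smul_eq_mul]

variable (d) in
/-- The ambiguity function of the Gaussian. -/
def gaussianAmbiguity : 𝓢(PhaseSpace d, ℂ) :=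
  crossAmbiguity (tensor (gaussian (Config d)) (gaussian (Config d)))

/-- By the parallelogram law the product of the two shifted Gaussians splits as e^{-π|w₁|²/2}
e^{-2π|q|²}, and the Fourier transform of the second factor supplies the constant 2^{-d/2}. Strict
positivity is what later permits division by this function. -/
lemma exists_gaussianAmbiguity_eq : ∃ c : ℝ, 0 < c ∧ ∀ w : PhaseSpace d,
    gaussianAmbiguity d w = ((c * Real.exp (-(π / 2) * (‖w.1‖ ^ 2 + ‖w.2‖ ^ 2)) : ℝ) : ℂ) := by
  refine ⟨(1 / 2) ^ ((d : ℝ) / 2), by positivity, fun w => ?_⟩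
  rw [gaussianAmbiguity, crossAmbiguity_tensor_apply]
  have hpar : ∀ q : Config d, ‖(1 / 2 : ℝ) • w.1 - q‖ ^ 2 + ‖-((1 / 2 : ℝ) • w.1) - q‖ ^ 2 =
      ‖w.1‖ ^ 2 / 2 + 2 * ‖q‖ ^ 2 := fun q => by
    have h1 := parallelogram_law_with_norm ℝ ((1 / 2 : ℝ) • w.1) q
    have h2 : ‖-((1 / 2 : ℝ) • w.1) - q‖ = ‖(1 / 2 : ℝ) • w.1 + q‖ := by
      rw [← norm_neg]; congr 1; abel
    rw [h2]
    rw [norm_smul, Real.norm_of_nonneg (by norm_num : (0 : ℝ) ≤ 1 / 2)] at h1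
    linarith
  have e : ∀ q : Config d, (𝐞 (-⟪q, w.2⟫_ℝ) : ℂ) *
      (gaussian (Config d) ((1 / 2 : ℝ) • w.1 - q) *
        gaussian (Config d) (-((1 / 2 : ℝ) • w.1) - q)) =
      Complex.exp (-(π / 2) * ‖w.1‖ ^ 2) *
        (𝐞 (-⟪q, w.2⟫_ℝ) • Complex.exp (-((2 * π : ℝ) : ℂ) * ‖q‖ ^ 2)) := fun q => by
    rw [gaussian_apply, gaussian_apply, ← Complex.exp_add, Circle.smul_def, smul_eq_mul,
      mul_left_comm, ← Complex.exp_add]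
    congr 2
    have := congrArg (fun r : ℝ => (r : ℂ)) (hpar q)
    push_cast at this ⊢
    linear_combination (-π : ℂ) * this
  simp_rw [e]
  rw [integral_const_mul, ← Real.fourier_eq,
    fourier_gaussian_innerProductSpace (by simpa using Real.pi_pos)]
  have hpi : (π : ℂ) ≠ 0 := by exact_mod_cast Real.pi_ne_zero
  have e1 : ((π : ℂ) / ((2 * π : ℝ) : ℂ)) = ((1 / 2 : ℝ) : ℂ) := by
    push_cast; field_simp
  rw [e1, finrank_euclideanSpace, Fintype.card_fin,
    show ((d : ℂ) / 2) = ((((d : ℝ) / 2 : ℝ)) : ℂ) by push_cast; rfl,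
    ← Complex.ofReal_cpow (by norm_num), mul_left_comm, ← Complex.exp_add]
  push_cast
  congr 2
  field_simp
  ring

lemma gaussianAmbiguity_ne_zero (w : PhaseSpace d) : gaussianAmbiguity d w ≠ 0 := by
  obtain ⟨c, hc, h⟩ := exists_gaussianAmbiguity_eq (d := d)
  rw [h]
  exact_mod_cast (mul_pos hc (Real.exp_pos _)).ne'

lemma conj_gaussianAmbiguity (w : PhaseSpace d) :
    (starRingEnd ℂ) (gaussianAmbiguity d w) = gaussianAmbiguity d w := by
  obtain ⟨c, hc, h⟩ := exists_gaussianAmbiguity_eq (d := d)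
  rw [h, Complex.conj_ofReal]

lemma conj_fourierChar (r : ℝ) : (starRingEnd ℂ) (𝐞 r : ℂ) = (𝐞 (-r) : ℂ) := by
  rw [AddChar.map_neg_eq_inv, Circle.coe_inv_eq_conj]

/-- The ambiguity functions of the coherent states. -/
lemma crossAmbiguity_coherent (z w : PhaseSpace d) :
    crossAmbiguity (tensor (conj (coherent z)) (coherent z)) w =
      𝐞 (-symplecticForm z w) * gaussianAmbiguity d w := by
  rw [gaussianAmbiguity, crossAmbiguity_tensor_apply, crossAmbiguity_tensor_apply,
    ← integral_const_mul, ← integral_sub_right_eq_self _ z.1]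
  congr 1 with q
  rw [conj_apply, coherent_apply, coherent_apply, map_mul, gaussian_conj, conj_fourierChar]
  have e1 : (1 / 2 : ℝ) • w.1 - (q - z.1) - z.1 = (1 / 2 : ℝ) • w.1 - q := by abel
  have e2 : -((1 / 2 : ℝ) • w.1) - (q - z.1) - z.1 = -((1 / 2 : ℝ) • w.1) - q := by abel
  -- The shift of q by `z.1` has centred both Gaussians; the remaining phases combine to the
  -- character of σ(z, ·) and the original Fourier phase.
  have e3 : (𝐞 (-⟪q - z.1, w.2⟫_ℝ) : ℂ) * (𝐞 (-⟪(1 / 2 : ℝ) • w.1 - (q - z.1), z.2⟫_ℝ) *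
      𝐞 ⟪-((1 / 2 : ℝ) • w.1) - (q - z.1), z.2⟫_ℝ) =
      𝐞 (-symplecticForm z w) * 𝐞 (-⟪q, w.2⟫_ℝ) := by
    simp only [← Circle.coe_mul, ← AddChar.map_add_eq_mul]
    congr 2
    simp only [symplecticForm, inner_sub_left, inner_neg_left, real_inner_smul_left]
    ring
  rw [e1, e2]
  linear_combination (gaussian (Config d) ((1 / 2 : ℝ) • w.1 - q) *
    gaussian (Config d) (-((1 / 2 : ℝ) • w.1) - q)) * e3

/-- The coherent states as elements of `L²`. -/
def coherentL2 (z : PhaseSpace d) : Lp ℂ 2 (volume : Measure (Config d)) := (coherent z).toLp 2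

/-- The symplectic Fourier transform of the product of the Gaussian with a cross-ambiguity function
is a product of short-time Fourier transforms. -/
lemma symplecticFourier_gaussianAmbiguity_mul (φ ψ : 𝓢(Config d, ℂ)) (z : PhaseSpace d) :
    symplecticFourier (reflect (mulS (gaussianAmbiguity d) (crossAmbiguity (tensor φ ψ)))) z =
      inner ℂ ((conj φ).toLp 2 : Lp ℂ 2 (volume : Measure (Config d))) (coherentL2 z) *
        inner ℂ (coherentL2 z) (ψ.toLp 2) := by
  -- The Moyal identity separates the pairing of the two ambiguity functions into a product of two
  -- inner products.
  have h1 := integral_inner_crossAmbiguity (tensor (conj (coherent z)) (coherent z)) (tensor φ ψ)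
  have h2 : symplecticFourier (reflect (mulS (gaussianAmbiguity d)
      (crossAmbiguity (tensor φ ψ)))) z =
      ∫ w, inner ℂ (crossAmbiguity (tensor (conj (coherent z)) (coherent z)) w)
        (crossAmbiguity (tensor φ ψ) w) := by
    rw [symplecticFourier_apply, ← integral_neg_eq_self]
    congr 1 with w
    rw [reflect_apply, neg_neg, mulS_apply, RCLike.inner_apply, crossAmbiguity_coherent, map_mul,
      conj_gaussianAmbiguity, conj_fourierChar, symplecticForm_neg_right, Circle.smul_def,
      smul_eq_mul]
    ring
  rw [h2, h1, coherentL2, inner_toL2_toL2_eq (conj φ) (coherent z) volume,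
    inner_toL2_toL2_eq (coherent z) ψ volume, Measure.volume_eq_prod,
    ← integral_prod_mul]
  congr 1 with p
  simp only [tensor_apply, RCLike.inner_apply, conj_apply, map_mul, RingHomCompTriple.comp_apply,
    RingHom.id_apply]
  ring

/-- At the origin the phase is trivial and both arguments are −q. This fixes the constant in the
resolution of the identity. -/
lemma crossAmbiguity_conj_zero (ψ : 𝓢(Config d, ℂ)) :
    crossAmbiguity (tensor (conj ψ) ψ) 0 =
      ((‖(ψ.toLp 2 : Lp ℂ 2 (volume : Measure (Config d)))‖ ^ 2 : ℝ) : ℂ) := by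
  rw [crossAmbiguity_tensor_apply, norm_toLp_two_sq, ← integral_complex_ofReal,
    ← integral_neg_eq_self]
  congr 1 with q
  simp only [Prod.snd_zero, Prod.fst_zero, inner_zero_right, neg_zero, AddChar.map_zero_eq_one,
    smul_zero, zero_sub, neg_neg, Circle.coe_one, one_mul, conj_apply]
  rw [Complex.conj_mul']
  push_cast
  rfl

/-- The Schwartz function `z ↦ |⟨g_z, ψ⟩|²`. -/
lemma exists_schwartz_normSq_inner_coherent (ψ : 𝓢(Config d, ℂ)) :
    ∃ Θ : 𝓢(PhaseSpace d, ℂ),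
      (∀ z, Θ z = ((‖inner ℂ (coherentL2 z) (ψ.toLp 2)‖ ^ 2 : ℝ) : ℂ)) ∧
      ∫ z, Θ z = gaussianAmbiguity d 0 *
        ((‖(ψ.toLp 2 : Lp ℂ 2 (volume : Measure (Config d)))‖ ^ 2 : ℝ) : ℂ) := by
  refine ⟨symplecticFourier (reflect (mulS (gaussianAmbiguity d)
    (crossAmbiguity (tensor (conj ψ) ψ)))), fun z => ?_, ?_⟩
  · rw [symplecticFourier_gaussianAmbiguity_mul, conj_conj, ← inner_conj_symm, Complex.conj_mul']
    push_cast
    rfl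
  -- The integral of Θ is its symplectic Fourier transform at 0, and Θ is itself a transform, so the
  -- involution evaluates it.
  · rw [← crossAmbiguity_conj_zero, ← mulS_apply, ← neg_zero, ← reflect_apply,
      ← symplecticFourier_symplecticFourier (reflect _), symplecticFourier_apply]
    simp [symplecticForm_zero_left, symplecticFourier_symplecticFourier]

lemma integrable_normSq_inner_coherent (ψ : 𝓢(Config d, ℂ)) :
    Integrable fun z : PhaseSpace d => ‖inner ℂ (coherentL2 z) (ψ.toLp 2)‖ ^ 2 := by
  obtain ⟨Θ, hΘ, -⟩ := exists_schwartz_normSq_inner_coherent ψ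
  refine (Θ.integrable (μ := volume)).norm.congr (Filter.Eventually.of_forall fun z => ?_)
  simp only [hΘ]
  rw [Complex.norm_real, Real.norm_of_nonneg (by positivity)]

/-- The resolution of the identity by coherent states, up to the constant G(0); it makes
localization operators bounded by the supremum of their symbol. -/
lemma integral_normSq_inner_coherent (ψ : 𝓢(Config d, ℂ)) :
    ∫ z : PhaseSpace d, ‖inner ℂ (coherentL2 z) (ψ.toLp 2)‖ ^ 2 =
      ‖gaussianAmbiguity d 0‖ * ‖(ψ.toLp 2 : Lp ℂ 2 (volume : Measure (Config d)))‖ ^ 2 := by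
  obtain ⟨Θ, hΘ, hi⟩ := exists_schwartz_normSq_inner_coherent ψ
  simp_rw [hΘ] at hi
  rw [integral_complex_ofReal] at hi
  have h := congrArg norm hi
  rw [norm_mul, Complex.norm_real, Complex.norm_real,
    Real.norm_of_nonneg (integral_nonneg fun z => by positivity),
    Real.norm_of_nonneg (by positivity)] at h
  exact h

/-- The square of this function is a Schwartz function of z. This is the weak convergence of
coherent states to 0, tested on a dense subspace. -/
lemma tendsto_inner_coherent_toLp (ψ : 𝓢(Config d, ℂ)) :
    Filter.Tendsto (fun z : PhaseSpace d => ‖inner ℂ (coherentL2 z) (ψ.toLp 2)‖)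
      (Filter.cocompact _) (nhds 0) := by
  obtain ⟨Θ, hΘ, -⟩ := exists_schwartz_normSq_inner_coherent ψ
  have h := (Θ.tendsto_cocompact.norm).sqrt
  simp only [norm_zero, Real.sqrt_zero] at h
  refine h.congr fun z => ?_
  rw [hΘ, Complex.norm_real, Real.norm_of_nonneg (by positivity), Real.sqrt_sq (norm_nonneg _)]

lemma norm_coherent_apply (z : PhaseSpace d) (t : Config d) :
    ‖coherent z t‖ = ‖gaussian (Config d) (t - z.1)‖ := by
  rw [coherent_apply, norm_mul, Circle.norm_coe, one_mul]

lemma norm_coherentL2_sq (z : PhaseSpace d) :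
    ‖coherentL2 z‖ ^ 2 = ∫ t, ‖gaussian (Config d) t‖ ^ 2 := by
  rw [coherentL2, norm_toLp_two_sq]
  simp_rw [norm_coherent_apply]
  exact integral_sub_right_eq_self (fun t => ‖gaussian (Config d) t‖ ^ 2) z.1

lemma exists_norm_coherentL2_eq : ∃ C : ℝ, 0 ≤ C ∧ ∀ z : PhaseSpace d, ‖coherentL2 z‖ = C :=
  ⟨√(∫ t, ‖gaussian (Config d) t‖ ^ 2), by positivity, fun z => by
    rw [← norm_coherentL2_sq z, Real.sqrt_sq (norm_nonneg _)]⟩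

lemma norm_gaussian_le_one (t : Config d) : ‖gaussian (Config d) t‖ ≤ 1 := by
  rw [gaussian_apply, Complex.norm_exp]
  refine Real.exp_le_one_iff.2 ?_
  have : (-(π : ℂ) * (‖t‖ : ℂ) ^ 2).re = -π * ‖t‖ ^ 2 := by
    rw [← Complex.ofReal_pow, ← Complex.ofReal_neg, ← Complex.ofReal_mul, Complex.ofReal_re]
  rw [this]
  have := Real.pi_pos
  nlinarith [sq_nonneg ‖t‖, mul_nonneg this.le (sq_nonneg ‖t‖)]

lemma continuous_inner_coherentL2 (w : PhaseSpace d) :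
    Continuous fun z : PhaseSpace d => inner ℂ (coherentL2 z) (coherentL2 w) := by
  simp only [coherentL2, inner_toL2_toL2_eq]
  refine continuous_of_dominated (bound := fun t => ‖coherent w t‖)
    (fun z => (Continuous.aestronglyMeasurable (by fun_prop)))
    (fun z => Filter.Eventually.of_forall fun t => ?_) (coherent w).integrable.norm
    (Filter.Eventually.of_forall fun t => ?_)
  · refine (norm_inner_le_norm _ _).trans (mul_le_of_le_one_left (norm_nonneg _) ?_)
    rw [norm_coherent_apply]
    exact norm_gaussian_le_one _
  · refine Continuous.inner ?_ continuous_const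
    simp only [coherent_apply, Real.fourierChar_apply]
    fun_prop

/-- All coherent states have the same norm, so convergence of their inner products with a fixed one
already forces convergence in norm. -/
lemma continuous_coherentL2 : Continuous (coherentL2 (d := d)) := by
  obtain ⟨C, -, hC⟩ := exists_norm_coherentL2_eq (d := d)
  refine continuous_iff_continuousAt.2 fun w => ?_
  rw [ContinuousAt, tendsto_iff_norm_sub_tendsto_zero]
  have h1 : ∀ z : PhaseSpace d, ‖coherentL2 z - coherentL2 w‖ =
      √(C ^ 2 - 2 * (inner ℂ (coherentL2 z) (coherentL2 w)).re + C ^ 2) := fun z => by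
    rw [← Real.sqrt_sq (norm_nonneg (coherentL2 z - coherentL2 w)), norm_sub_sq (𝕜 := ℂ), hC, hC]
    rfl
  have h2 : Continuous fun z : PhaseSpace d =>
      √(C ^ 2 - 2 * (inner ℂ (coherentL2 z) (coherentL2 w)).re + C ^ 2) :=
    ((continuous_const.sub (continuous_const.mul
      (Complex.continuous_re.comp (continuous_inner_coherentL2 w)))).add continuous_const).sqrt
  simp_rw [h1]
  convert h2.tendsto w using 2
  rw [← h1, sub_self, norm_zero]

end CoherentStates

/-! ### Compact operators on a Hilbert space. -/

section HilbertSpace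
variable {H : Type*} [NormedAddCommGroup H] [InnerProductSpace ℂ H]

/-- The quadratic form of a compact operator tends to zero along a bounded weakly null family. -/
lemma tendsto_inner_apply_of_isCompactOperator {α : Type*} {l : Filter α} {g : α → H} {C : ℝ}
    (hC : ∀ a, ‖g a‖ ≤ C) (hg : ∀ f, Filter.Tendsto (fun a => ‖inner ℂ (g a) f‖) l (nhds 0))
    {T : H →L[ℂ] H} (hT : IsCompactOperator T) :
    Filter.Tendsto (fun a => inner ℂ (g a) (T (g a))) l (nhds 0) := by
  rw [Metric.tendsto_nhds]
  intro ε hε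
  have hC' : 0 < |C| + 1 := by positivity
  -- A finite net of the relatively compact set containing all `T (g a)`; weak convergence is then
  -- needed only against its finitely many centres.
  obtain ⟨t, -, htf, ht⟩ := (hT.isCompact_closure_image_closedBall
    (f := (T : H →ₗ[ℂ] H)) C).finite_cover_balls (e := ε / 2 / (|C| + 1)) (by positivity)
  filter_upwards [(Filter.eventually_all_finite htf).2 fun c _ =>
    (hg c).eventually_lt_const (half_pos hε)] with a ha
  obtain ⟨c, hct, hc⟩ := Set.mem_iUnion₂.1 (ht (subset_closure
    (Set.mem_image_of_mem _ (mem_closedBall_zero_iff.2 (hC a)))))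
  rw [mem_ball_iff_norm] at hc
  rw [dist_zero_right]
  change ‖T (g a) - c‖ < _ at hc
  calc ‖inner ℂ (g a) (T (g a))‖ = ‖inner ℂ (g a) (T (g a) - c) + inner ℂ (g a) c‖ := by
        rw [inner_sub_right, sub_add_cancel]
    _ ≤ ‖g a‖ * ‖T (g a) - c‖ + ‖inner ℂ (g a) c‖ :=
        (norm_add_le _ _).trans (by gcongr; exact norm_inner_le_norm _ _)
    _ < ε / 2 + ε / 2 := by
        refine add_lt_add_of_le_of_lt ?_ (ha c hct)
        calc ‖g a‖ * ‖T (g a) - c‖ ≤ (|C| + 1) * (ε / 2 / (|C| + 1)) :=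
              mul_le_mul ((hC a).trans ((le_abs_self C).trans (by simp))) hc.le (norm_nonneg _)
                hC'.le
          _ = ε / 2 := by field_simp
    _ = ε := add_halves ε

/-- A bounded family which is weakly null on a dense set is weakly null. -/
lemma tendsto_norm_inner_of_denseRange {α ι : Type*} {l : Filter α} {g : α → H} {C : ℝ}
    (hC : ∀ a, ‖g a‖ ≤ C) {e : ι → H} (he : DenseRange e)
    (hg : ∀ i, Filter.Tendsto (fun a => ‖inner ℂ (g a) (e i)‖) l (nhds 0)) (f : H) :
    Filter.Tendsto (fun a => ‖inner ℂ (g a) f‖) l (nhds 0) := by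
  rw [Metric.tendsto_nhds]
  intro ε hε
  have hC' : 0 < |C| + 1 := by positivity
  obtain ⟨i, hi⟩ := he.exists_dist_lt f (ε := ε / 2 / (|C| + 1)) (by positivity)
  rw [dist_eq_norm] at hi
  filter_upwards [(hg i).eventually_lt_const (half_pos hε)] with a ha
  rw [dist_zero_right, norm_norm]
  calc ‖inner ℂ (g a) f‖ = ‖inner ℂ (g a) (f - e i) + inner ℂ (g a) (e i)‖ := by
        rw [inner_sub_right, sub_add_cancel]
    _ ≤ ‖g a‖ * ‖f - e i‖ + ‖inner ℂ (g a) (e i)‖ :=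
        (norm_add_le _ _).trans (by gcongr; exact norm_inner_le_norm _ _)
    _ < ε / 2 + ε / 2 := by
        refine add_lt_add_of_le_of_lt ?_ ha
        calc ‖g a‖ * ‖f - e i‖ ≤ (|C| + 1) * (ε / 2 / (|C| + 1)) :=
              mul_le_mul ((hC a).trans ((le_abs_self C).trans (by simp))) hi.le (norm_nonneg _)
                hC'.le
          _ = ε / 2 := by field_simp
    _ = ε := add_halves ε

lemma isCompactOperator_rankOne (x y : H) :
    IsCompactOperator (InnerProductSpace.rankOne ℂ x y : H →L[ℂ] H) := by
  rw [InnerProductSpace.rankOne_def']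
  have h : IsCompactOperator (innerSL ℂ y : H →L[ℂ] ℂ) :=
    isCompactOperator_of_locallyCompactSpace_dom _
  exact h.clm_comp (ContinuousLinearMap.toSpanSingleton ℂ x)

lemma continuous_rankOne {Z : Type*} [TopologicalSpace Z] {g : Z → H} (hg : Continuous g) :
    Continuous fun z => (InnerProductSpace.rankOne ℂ (g z) (g z) : H →L[ℂ] H) := by
  simp_rw [InnerProductSpace.rankOne_def']
  exact ((ContinuousLinearMap.toSpanSingletonCLE (𝕜 := ℂ) (E := H)).continuous.comp hg).clm_comp
    ((innerSL ℂ).continuous.comp hg)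

/-- The integral of a family of compact operators is compact. -/
lemma isCompactOperator_integral [CompleteSpace H] {Z : Type*} [MeasurableSpace Z]
    {μ : Measure Z} {A : Z → H →L[ℂ] H} (hA : ∀ z, IsCompactOperator (A z))
    (hi : Integrable A μ) : IsCompactOperator (∫ z, A z ∂μ : H →L[ℂ] H) := by
  -- The compact operators form a closed, hence complete, subspace, so the integral may be taken
  -- inside it.
  let K : Submodule ℂ (H →L[ℂ] H) := compactOperator (RingHom.id ℂ) H H
  have hK : IsClosed (K : Set (H →L[ℂ] H)) := isClosed_setOfPred_isCompactOperator
  have : CompleteSpace K := hK.completeSpace_coe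
  by_contra h
  have hmem : (∫ z, A z ∂μ) ∉ K := h
  obtain ⟨B, hB⟩ : ∃ B : Z → K, ∀ z, (B z : H →L[ℂ] H) = A z := ⟨fun z => ⟨A z, hA z⟩, fun z => rfl⟩
  have hBi : Integrable B μ := by
    refine ⟨?_, ?_⟩
    · refine (Topology.IsEmbedding.subtypeVal.aestronglyMeasurable_comp_iff).1 ?_
      exact hi.aestronglyMeasurable.congr (Filter.Eventually.of_forall fun z => (hB z).symm)
    · refine hi.hasFiniteIntegral.congr' (Filter.Eventually.of_forall fun z => ?_)
      rw [← hB]; rfl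
  have h2 := K.subtypeL.integral_comp_comm hBi
  refine hmem ?_
  have h3 : ∫ z, A z ∂μ = K.subtypeL (∫ z, B z ∂μ) := by
    rw [← h2]
    congr 1 with z : 1
    exact (hB z).symm
  rw [h3]
  exact (∫ z, B z ∂μ).2

end HilbertSpace

/-! ### Localization operators. -/

section Localization
variable {d : ℕ}

lemma denseRange_toLp_two {E : Type*} [NormedAddCommGroup E] [NormedSpace ℝ E]
    [FiniteDimensional ℝ E] [MeasurableSpace E] [BorelSpace E] (μ : Measure E)
    [μ.HasTemperateGrowth] [IsFiniteMeasureOnCompacts μ] :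
    DenseRange fun ψ : 𝓢(E, ℂ) => ψ.toLp 2 μ :=
  SchwartzMap.denseRange_toLpCLM (F := ℂ) (μ := μ) (p := 2) ENNReal.ofNat_ne_top

lemma toTemperedDistribution_eq_inner {E : Type*} [NormedAddCommGroup E] [NormedSpace ℝ E]
    [MeasurableSpace E] [BorelSpace E] [SecondCountableTopology E] {μ : Measure E}
    [μ.HasTemperateGrowth] (f : Lp ℂ 2 μ) (φ : 𝓢(E, ℂ)) :
    Lp.toTemperedDistribution f φ = inner ℂ ((conj φ).toLp 2 μ) f := by
  rw [Lp.toTemperedDistribution_apply, L2.inner_def]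
  refine integral_congr_ae ?_
  filter_upwards [(conj φ).coeFn_toLp 2 μ] with x hx
  rw [hx, RCLike.inner_apply, conj_apply, smul_eq_mul, RCLike.conj_conj, mul_comm]

/-- The integrand of the localization operator with symbol `f`. -/
def localizationDensity (f : C₀(PhaseSpace d, ℂ)) (z : PhaseSpace d) :
    Lp ℂ 2 (volume : Measure (Config d)) →L[ℂ] Lp ℂ 2 (volume : Measure (Config d)) :=
  f z • InnerProductSpace.rankOne ℂ (coherentL2 z) (coherentL2 z)

lemma inner_localizationDensity (f : C₀(PhaseSpace d, ℂ)) (z : PhaseSpace d)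
    (a b : Lp ℂ 2 (volume : Measure (Config d))) :
    inner ℂ a (localizationDensity f z b) =
      f z * (inner ℂ a (coherentL2 z) * inner ℂ (coherentL2 z) b) := by
  rw [localizationDensity, smul_apply, InnerProductSpace.rankOne_apply,
    inner_smul_right, inner_smul_right, mul_comm (inner ℂ a _)]

lemma integrableOn_localizationDensity (f : C₀(PhaseSpace d, ℂ)) (r : ℝ) :
    IntegrableOn (localizationDensity f) (Metric.closedBall 0 r) := by
  refine ContinuousOn.integrableOn_compact (isCompact_closedBall 0 r) (Continuous.continuousOn ?_)
  unfold localizationDensity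
  exact f.continuous.smul (continuous_rankOne continuous_coherentL2)

lemma inner_setIntegral_localizationDensity (f : C₀(PhaseSpace d, ℂ)) {S : Set (PhaseSpace d)}
    (hS : IntegrableOn (localizationDensity f) S) (a b : Lp ℂ 2 (volume : Measure (Config d))) :
    inner ℂ a ((∫ z in S, localizationDensity f z) b) =
      ∫ z in S, f z * (inner ℂ a (coherentL2 z) * inner ℂ (coherentL2 z) b) := by
  rw [ContinuousLinearMap.integral_apply hS, ← integral_inner (hS.apply_continuousLinearMap b)]
  simp_rw [inner_localizationDensity]

lemma memLp_norm_inner_coherent (c : 𝓢(Config d, ℂ)) :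
    MemLp (fun z : PhaseSpace d => ‖inner ℂ (coherentL2 z) (c.toLp 2)‖) 2 := by
  rw [memLp_two_iff_integrable_sq]
  · exact integrable_normSq_inner_coherent c
  · exact ((continuous_coherentL2.inner continuous_const).norm).aestronglyMeasurable

/-- Cauchy–Schwarz on phase space, with both factors evaluated by the resolution of the identity. -/
lemma integral_norm_inner_coherent_mul_le (a b : 𝓢(Config d, ℂ)) :
    ∫ z : PhaseSpace d, ‖inner ℂ (coherentL2 z) (a.toLp 2)‖ *
        ‖inner ℂ (coherentL2 z) (b.toLp 2)‖ ≤
      ‖gaussianAmbiguity d 0‖ * ‖(a.toLp 2 : Lp ℂ 2 (volume : Measure (Config d)))‖ *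
        ‖(b.toLp 2 : Lp ℂ 2 (volume : Measure (Config d)))‖ := by
  have h2 : ENNReal.ofReal 2 = 2 := by simp
  refine (integral_mul_le_Lp_mul_Lq_of_nonneg Real.HolderConjugate.two_two
    (Filter.Eventually.of_forall fun z => norm_nonneg _)
    (Filter.Eventually.of_forall fun z => norm_nonneg _)
    (by rw [h2]; exact memLp_norm_inner_coherent a)
    (by rw [h2]; exact memLp_norm_inner_coherent b)).trans_eq ?_
  simp only [Real.rpow_two, integral_normSq_inner_coherent]
  rw [← Real.sqrt_eq_rpow, ← Real.sqrt_eq_rpow, ← Real.sqrt_mul (by positivity)]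
  refine (congrArg Real.sqrt ?_).trans (Real.sqrt_sq (by positivity))
  ring

/-- The bound involves only the supremum of f on S, not the measure of S, since the sesquilinear
form is estimated first on Schwartz functions and then extended by density. -/
lemma norm_setIntegral_localizationDensity_le (f : C₀(PhaseSpace d, ℂ)) {S : Set (PhaseSpace d)}
    (hSm : MeasurableSet S) (hS : IntegrableOn (localizationDensity f) S) {ε : ℝ} (hε : 0 ≤ ε)
    (hf : ∀ z ∈ S, ‖f z‖ ≤ ε) :
    ‖∫ z in S, localizationDensity f z‖ ≤ ε * ‖gaussianAmbiguity d 0‖ := by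
  set T := ∫ z in S, localizationDensity f z with hT
  set M := ‖gaussianAmbiguity d 0‖ with hM
  have key : ∀ a b : Lp ℂ 2 (volume : Measure (Config d)),
      ‖inner ℂ a (T b)‖ ≤ ε * (M * ‖a‖ * ‖b‖) := by
    refine (denseRange_toLp_two volume).induction_on₂ (isClosed_le (by fun_prop) (by fun_prop))
      fun a b => ?_
    obtain ⟨F, hF⟩ : ∃ F : PhaseSpace d → ℝ, ∀ z, F z = ‖inner ℂ (coherentL2 z) (a.toLp 2)‖ *
        ‖inner ℂ (coherentL2 z) (b.toLp 2)‖ := ⟨_, fun _ => rfl⟩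
    have hFi : Integrable F := by
      rw [funext hF]
      exact (memLp_norm_inner_coherent a).integrable_mul (memLp_norm_inner_coherent b)
    have hF0 : ∀ z, 0 ≤ F z := fun z => by rw [hF]; positivity
    have hFle := integral_norm_inner_coherent_mul_le a b
    rw [← funext hF] at hFle
    have h1 : ∀ᵐ z ∂(volume.restrict S), ‖f z * (inner ℂ (a.toLp 2) (coherentL2 z) *
        inner ℂ (coherentL2 z) (b.toLp 2))‖ ≤ ε * F z := by
      filter_upwards [ae_restrict_mem hSm] with z hz
      rw [norm_mul, norm_mul, norm_inner_symm, hF]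
      gcongr
      exact hf z hz
    rw [hT, inner_setIntegral_localizationDensity f hS]
    refine (norm_integral_le_of_norm_le (hFi.const_mul ε).integrableOn h1).trans ?_
    rw [integral_const_mul]
    refine mul_le_mul_of_nonneg_left (le_trans ?_ hFle) hε
    exact setIntegral_le_integral hFi (Filter.Eventually.of_forall hF0)
  refine ContinuousLinearMap.opNorm_le_bound _ (by positivity) fun b => ?_
  by_cases h0 : ‖T b‖ = 0
  · rw [h0]; positivity
  · have h1 := key (T b) b
    -- With a = T b, the bound on the form becomes the bound on ‖T b‖ after one factor is cancelled.
    rw [inner_self_eq_norm_sq_to_K, norm_pow, RCLike.norm_ofReal, abs_norm] at h1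
    have h3 : 0 < ‖T b‖ := lt_of_le_of_ne (norm_nonneg _) (Ne.symm h0)
    refine le_of_mul_le_mul_left ?_ h3
    linarith

/-- Localization operators with a symbol vanishing at infinity are compact. -/
lemma exists_isCompactOperator_localization (f : C₀(PhaseSpace d, ℂ)) :
    ∃ T : Lp ℂ 2 (volume : Measure (Config d)) →L[ℂ] Lp ℂ 2 (volume : Measure (Config d)),
      IsCompactOperator T ∧ ∀ a b, Integrable (fun z : PhaseSpace d =>
          inner ℂ a (coherentL2 z) * inner ℂ (coherentL2 z) b) →
        inner ℂ a (T b) =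
          ∫ z : PhaseSpace d, f z * (inner ℂ a (coherentL2 z) * inner ℂ (coherentL2 z) b) := by
  set Tn : ℕ → Lp ℂ 2 (volume : Measure (Config d)) →L[ℂ] Lp ℂ 2 (volume : Measure (Config d)) :=
    fun n => ∫ z in Metric.closedBall 0 (n : ℝ), localizationDensity f z with hTn
  set M := ‖gaussianAmbiguity d 0‖ with hM
  have hcauchy : CauchySeq Tn := by
    rw [Metric.cauchySeq_iff']
    intro ε hε
    -- The rank-one operators have constant norm, so the integral over all of phase space need not
    -- converge absolutely. Two truncations differ by an integral over a shell, where |f| is at most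
    -- this number, so that ε M/(M + 1) < ε.
    have hpos : 0 < ε / (M + 1) := by positivity
    have h1 := (f.zero_at_infty'.norm).eventually_lt_const (u := ε / (M + 1)) (by simpa using hpos)
    rw [← Metric.cobounded_eq_cocompact,
      (Metric.hasBasis_cobounded_compl_closedBall (0 : PhaseSpace d)).eventually_iff] at h1
    obtain ⟨r, -, hr⟩ := h1
    obtain ⟨N, hN⟩ := exists_nat_ge r
    refine ⟨N, fun n hn => ?_⟩
    have hsub : Metric.closedBall (0 : PhaseSpace d) N ⊆ Metric.closedBall 0 n :=
      Metric.closedBall_subset_closedBall (by exact_mod_cast hn)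
    rw [dist_eq_norm, hTn]
    simp only
    rw [← setIntegral_sdiff Metric.isClosed_closedBall.measurableSet
      (integrableOn_localizationDensity f n) hsub]
    refine (norm_setIntegral_localizationDensity_le f
      (Metric.isClosed_closedBall.measurableSet.diff Metric.isClosed_closedBall.measurableSet)
      ((integrableOn_localizationDensity f n).mono_set Set.sdiff_subset) hpos.le
      fun z hz => (hr fun hz' => hz.2 (Metric.closedBall_subset_closedBall hN hz')).le).trans_lt ?_
    rw [div_mul_eq_mul_div, div_lt_iff₀ (by positivity)]
    nlinarith
  obtain ⟨T, hT⟩ := cauchySeq_tendsto_of_complete hcauchy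
  refine ⟨T, isCompactOperator_of_tendsto hT (Filter.Eventually.of_forall fun n => ?_),
    fun a b hab => ?_⟩
  · refine isCompactOperator_integral (fun z => ?_) (integrableOn_localizationDensity f n)
    exact (isCompactOperator_rankOne _ _).smul (f z)
  · have hlim : Filter.Tendsto (fun n => inner ℂ a (Tn n b)) Filter.atTop
        (nhds (inner ℂ a (T b))) :=
      tendsto_const_nhds.inner
        (((ContinuousLinearMap.apply ℂ (Lp ℂ 2 (volume : Measure (Config d))) b).continuous.tendsto
          T).comp hT)
    refine tendsto_nhds_unique hlim ?_
    have hU : ⋃ n : ℕ, Metric.closedBall (0 : PhaseSpace d) n = Set.univ :=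
      Metric.iUnion_closedBall_nat 0
    have hi : Integrable fun z : PhaseSpace d =>
        f z * (inner ℂ a (coherentL2 z) * inner ℂ (coherentL2 z) b) :=
      hab.bdd_mul f.continuous.aestronglyMeasurable
        (Filter.Eventually.of_forall fun z => f.toBCF.norm_coe_le_norm z)
    have h := tendsto_setIntegral_of_monotone (s := fun n : ℕ =>
      Metric.closedBall (0 : PhaseSpace d) n) (μ := volume)
      (fun n => Metric.isClosed_closedBall.measurableSet)
      (fun m n hmn => Metric.closedBall_subset_closedBall (by exact_mod_cast hmn))
      hi.integrableOn
    rw [hU, setIntegral_univ] at h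
    refine h.congr fun n => ?_
    exact (inner_setIntegral_localizationDensity f (integrableOn_localizationDensity f n) a b).symm

end Localization

/-! ### The two implications. -/

section Main
variable {d : ℕ}

/-- A compactly supported smooth function is divisible by the ambiguity function of the
Gaussian. -/
lemma exists_mulS_gaussianAmbiguity_eq (χ : 𝓢(PhaseSpace d, ℂ)) (hχ : HasCompactSupport χ) :
    ∃ h : 𝓢(PhaseSpace d, ℂ), mulS h (gaussianAmbiguity d) = χ := by
  have hc : HasCompactSupport fun w => χ w * (gaussianAmbiguity d w)⁻¹ := hχ.mul_right
  refine ⟨hc.toSchwartzMap ((χ.smooth ⊤).mul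
    (((gaussianAmbiguity d).smooth ⊤).inv gaussianAmbiguity_ne_zero)), ?_⟩
  ext w
  rw [mulS_apply]
  exact inv_mul_cancel_right₀ (gaussianAmbiguity_ne_zero w) (χ w)

/-- Compactness makes the quadratic form on coherent states a C₀ function. It represents F_σ(Gu),
and multiplication by h = χ/G then removes the Gaussian. -/
lemma vanishesAtInfinity_of_isCompactOnL2 {u : 𝓢'(PhaseSpace d, ℂ)}
    {χ : 𝓢(PhaseSpace d, ℂ)} (hc : HasCompactSupport χ) (hχ : mulDistr χ u = u)
    (hu : IsCompactOnL2 (rho u)) : VanishesAtInfinity (symplecticFourierDistr u) := by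
  obtain ⟨T, hT, hTu⟩ := hu
  obtain ⟨h, hh⟩ := exists_mulS_gaussianAmbiguity_eq χ hc
  obtain ⟨C, -, hC⟩ := exists_norm_coherentL2_eq (d := d)
  -- The kernel pairing is bilinear and the inner product sesquilinear, hence the conjugate in the
  -- first slot of the tensor.
  have hB : ∀ z : PhaseSpace d, u (crossAmbiguity (tensor (conj (coherent z)) (coherent z))) =
      inner ℂ (coherentL2 z) (T (coherentL2 z)) := fun z => by
    rw [← rho_apply, hTu, toTemperedDistribution_eq_inner, conj_conj]
    rfl
  have hG : VanishesAtInfinity (symplecticFourierDistr (mulDistr (gaussianAmbiguity d) u)) := by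
    refine ⟨⟨⟨fun z => inner ℂ (coherentL2 z) (T (coherentL2 z)),
      continuous_coherentL2.inner (T.continuous.comp continuous_coherentL2)⟩,
      tendsto_inner_apply_of_isCompactOperator (fun z => (hC z).le)
        (tendsto_norm_inner_of_denseRange (fun z => (hC z).le) (denseRange_toLp_two volume)
          tendsto_inner_coherent_toLp) hT⟩, fun φ => ?_⟩
    rw [symplecticFourierDistr_mulDistr_eq_integral hχ (gaussianAmbiguity d)
      (fun z => crossAmbiguity (tensor (conj (coherent z)) (coherent z)))
      crossAmbiguity_coherent φ]
    simp_rw [hB]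
    rfl
  have e : mulDistr h (mulDistr (gaussianAmbiguity d) u) = u := by
    conv_rhs => rw [← hχ]
    ext φ
    simp only [mulDistr_apply]
    rw [mulS_mulS, mulS_comm (gaussianAmbiguity d), hh]
  rw [← e]
  exact vanishesAtInfinity_mulDistr hG h

/-- With h = χ/G, the symbol f = F_σ(hu) is in C₀, and its localization operator is ρ(G·hu) = ρ(χu)
= ρ(u). -/
lemma isCompactOnL2_of_vanishesAtInfinity {u : 𝓢'(PhaseSpace d, ℂ)}
    {χ : 𝓢(PhaseSpace d, ℂ)} (hc : HasCompactSupport χ) (hχ : mulDistr χ u = u)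
    (hu : VanishesAtInfinity (symplecticFourierDistr u)) : IsCompactOnL2 (rho u) := by
  obtain ⟨h, hh⟩ := exists_mulS_gaussianAmbiguity_eq χ hc
  obtain ⟨f, hf⟩ := vanishesAtInfinity_mulDistr hu h
  obtain ⟨T, hT, hTf⟩ := exists_isCompactOperator_localization f
  refine ⟨T, hT, fun ψ => ?_⟩
  ext φ
  rw [toTemperedDistribution_eq_inner, hTf]
  · simp_rw [← symplecticFourier_gaussianAmbiguity_mul]
    rw [← hf, ← apply_eq_symplecticFourierDistr, rho_apply, mulDistr_apply, mulS_mulS, hh,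
      ← mulDistr_apply, hχ]
  · simp_rw [← symplecticFourier_gaussianAmbiguity_mul]
    exact SchwartzMap.integrable _

end Main

end

end WeylQuantization

theorem theorem4p3 (d : ℕ) (u : 𝓢'(PhaseSpace d, ℂ))
    (hu : IsCompact (Distribution.dsupport u)) :
    IsCompactOnL2 (weylOp (symplecticFourierDistr u)) ↔
      VanishesAtInfinity (symplecticFourierDistr u) := by
  obtain ⟨χ, hc, hχ⟩ := exists_mulDistr_eq_self u hu
  rw [weylOp_symplecticFourierDistr]
  exact ⟨vanishesAtInfinity_of_isCompactOnL2 hc hχ, isCompactOnL2_of_vanishesAtInfinity hc hχ⟩
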